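/- Let $\alpha>0$, let $m\ge 0$ be an integer, let $d,A,B,C,a$ be real numbers with $A>0$, and consider for $x,t>0$ the equation $$D_t^{\alpha}u=t^m\left(Ax^{d}u_{xx}+Bx^{d-1}u_x+Cx^{d-2}u\right),\qquad (*)$$ where $D_t^\alpha f=\frac{d^n}{dt^n}\,\frac{1}{\Gamma(n-\alpha)}\int_0^t (t-\tau)^{n-\alpha-1}f(\tau)\,d\tau$ with $n=[\alpha]+1$ is the Riemann–Liouville derivative. For $d\ne 2$ put $$s_{1,2}=\frac{\alpha+m}{2(2-d)}\left(\frac BA+2a-1\pm\sqrt{\left(1-\frac BA\right)^2-\frac{4C}{A}}\right)\in\mathbb C .$$ A solution of $(*)$ is a function $u(x,t)$, complex-valued in general, on $x,t>0$ that is twice continuously differentiable in $x$, for which $u(x,\cdot)$ and the integrand above (with $f=u(x,\cdot)$) are integrable on $(0,t)$, the fractional integral of order $n-\alpha$ is $n$ times continuously differentiable in $t>0$, and $(*)$ holds. The Fox function is $$H^{m+2,0}_{1,m+2}\left[z\left|\begin{matrix}(a_1,\alpha_1)\\(b_j,1)_{1,m+2}\end{matrix}\right.\right]=\frac1{2\pi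 i}\int_{\gamma-i\infty}^{\gamma+i\infty}\frac{\prod_{j=1}^{m+2}\Gamma(b_j-s)}{\Gamma(a_1-\alpha_1 s)}\,z^{s}\,ds,$$ where $\gamma$ is any real number with $\gamma<\operatorname{Re} b_j$ for all $j$, and the generalized Wright function is $${}_p\Psi_q\left[z\left|\begin{matrix}(a_i,\alpha_i)_{1,p}\\(b_j,\beta_j)_{1,q}\end{matrix}\right.\right]=\sum_{n=0}^\infty\frac{\prod_{i=1}^p\Gamma(a_i+\alpha_i n)}{\prod_{j=1}^q\Gamma(b_j+\beta_j n)}\frac{z^n}{n!},$$ with $1/\Gamma$ read as $0$ at the poles of $\Gamma$. In the sums below the $c_k$ are arbitrary complex constants, subject to the condition that, for each $k$ with $c_k\neq 0$, no Gamma function in a numerator of the corresponding Wright series is evaluated at a pole, i.e. the first entries of its upper parameters are not in $\{0,-1,-2,\dots\}$. 1. If $0<\alpha<2$ and $d\ne2$, then for every constant $c_1$ and every admissible $\gamma$ the function $$u(x,t)=c_1x^aH_{1,m+2}^{m+2,0}\left[\frac{x^{2-d}}{A(d-2)^2(\alpha+m)^{m}t^{\alpha+m}}\left|\begin{matrix}(1,\alpha+m)\\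 \left(-\frac{s_1}{\alpha+m},1\right),\left(-\frac{s_2}{\alpha+m},1\right),\left(\frac{j}{\alpha+m},1\right)_{1,m}\end{matrix}\right.\right]$$ is a solution of $(*)$, and the integral defining this $H$ converges absolutely for every positive argument. 2. If $\alpha>2$ and $d\ne2$, then $$u(x,t)=x^a\sum_{k=1}^{[\alpha]+1}c_kx^{\frac{(d-2)(\alpha-k)}{\alpha+m}}t^{\alpha-k}\,{}_{m+3}\Psi_1\left[A(d-2)^2(\alpha+m)^{m}x^{d-2}t^{\alpha+m}\left|\begin{matrix}\left(\frac{\alpha-k-s_1}{\alpha+m},1\right),\left(\frac{\alpha-k-s_2}{\alpha+m},1\right),\left(\frac{\alpha-k+i}{\alpha+m},1\right)_{1,m},(1,1)\\(1+\alpha-k,\alpha+m)\end{matrix}\right.\right]$$ is a solution of $(*)$. 3. If $d=2$, then, with $K=Aa^2-Aa+Ba+C$, $$u(x,t)=x^a\sum_{k=1}^{[\alpha]+1}c_kt^{\alpha-k}\,{}_{m+1}\Psi_1\left[K(\alpha+m)^m t^{\alpha+m}\left|\begin{matrix}\left(\frac{\alpha-k+i}{\alpha+m},1\right)_{1,m},(1,1)\\(1+\alpha-k,\alpha+m)\end{matrix}\right.\right]$$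 is a solution of $(*)$. In 2 and 3 the Wright series with $c_k\ne0$ converge absolutely for every complex argument. -/

import Mathlib

open MeasureTheory Set

noncomputable section

namespace FracDiff

/-! Special functions -/

/-- The integrand of the Mellin-Barnes integral of the Fox function `H_{p,q}^{m,l}` with upper
parameters `(a i, v i)`, `i < p`, and lower parameters `(b j, w j)`, `j < q`. The reciprocal of the
Gamma function is entire and vanishes at the poles of Gamma, which agrees with `0⁻¹ = 0`. -/
def foxHIntegrand {p q : ℕ} (m l : ℕ) (a : Fin p → ℂ) (v : Fin p → ℝ)
    (b : Fin q → ℂ) (w : Fin q → ℝ) (z s : ℂ) : ℂ :=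
  (∏ j : Fin q, if (j : ℕ) < m then Complex.Gamma (b j - w j * s)
      else (Complex.Gamma (1 - b j + w j * s))⁻¹) *
    (∏ i : Fin p, if (i : ℕ) < l then Complex.Gamma (1 - a i + v i * s)
      else (Complex.Gamma (a i - v i * s))⁻¹) *
    z ^ s

/-- The vertical line `Re s = γ` has the poles of `Γ(b j - w j s)`, `j < m`, on its right and the
poles of `Γ(1 - a i + v i s)`, `i < l`, on its left (for positive `w j`, `v i`). -/
def IsSeparatingLine {p q : ℕ} (m l : ℕ) (a : Fin p → ℂ) (v : Fin p → ℝ)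
    (b : Fin q → ℂ) (w : Fin q → ℝ) (γ : ℝ) : Prop :=
  (∀ j : Fin q, (j : ℕ) < m → w j * γ < (b j).re) ∧
    (∀ i : Fin p, (i : ℕ) < l → (a i).re - 1 < v i * γ)

/-- Absolute convergence of the Mellin-Barnes integral along the line `Re s = γ`. -/
def FoxHConverges {p q : ℕ} (m l : ℕ) (a : Fin p → ℂ) (v : Fin p → ℝ)
    (b : Fin q → ℂ) (w : Fin q → ℝ) (γ : ℝ) (z : ℂ) : Prop :=
  Integrable (fun y : ℝ => foxHIntegrand m l a v b w z (γ + y * Complex.I))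

/-- The Fox function `H_{p,q}^{m,l}[z]`, as the integral `(1 / 2πi) ∫_L … ds` along the line
`Re s = γ` from `γ - i∞` to `γ + i∞`; here `ds = i dy`. -/
def foxH {p q : ℕ} (m l : ℕ) (a : Fin p → ℂ) (v : Fin p → ℝ)
    (b : Fin q → ℂ) (w : Fin q → ℝ) (γ : ℝ) (z : ℂ) : ℂ :=
  (2 * Real.pi : ℂ)⁻¹ * ∫ y : ℝ, foxHIntegrand m l a v b w z (γ + y * Complex.I)

/-- The `n`-th term of the series of the generalized Wright function `_pΨ_q[z]` with upper
parameters `(a i, v i)` and lower parameters `(b j, w j)`. -/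
def wrightTerm {p q : ℕ} (a : Fin p → ℂ) (v : Fin p → ℝ) (b : Fin q → ℂ) (w : Fin q → ℝ)
    (z : ℂ) (n : ℕ) : ℂ :=
  (∏ i : Fin p, Complex.Gamma (a i + v i * n)) / (∏ j : Fin q, Complex.Gamma (b j + w j * n)) *
    (z ^ n / (n.factorial : ℂ))

/-- The generalized Wright function `_pΨ_q[z]`. -/
def wright {p q : ℕ} (a : Fin p → ℂ) (v : Fin p → ℝ) (b : Fin q → ℂ) (w : Fin q → ℝ)
    (z : ℂ) : ℂ :=
  ∑' n : ℕ, wrightTerm a v b w z n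

/-- No Gamma factor in a numerator of the series of `_pΨ_q` is evaluated at a pole, i.e. every term
of the series is defined. -/
def WrightDefined {p : ℕ} (a : Fin p → ℂ) (v : Fin p → ℝ) : Prop :=
  ∀ (i : Fin p) (n N : ℕ), a i + v i * n ≠ -(N : ℂ)

/-! Riemann-Liouville derivative -/

/-- The Riemann-Liouville fractional integral of order `β > 0` with base point `0`. -/
def rlIntegral (β : ℝ) (f : ℝ → ℂ) (t : ℝ) : ℂ :=
  (Real.Gamma β : ℂ)⁻¹ * ∫ τ in (0 : ℝ)..t, (((t - τ) ^ (β - 1) : ℝ) : ℂ) * f τ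

/-- The Riemann-Liouville derivative of order `α ≥ 0` with base point `0`:
`(d/dt)^n I^{n-α} f` with `n = [α] + 1`. -/
def rlDeriv (α : ℝ) (f : ℝ → ℂ) (t : ℝ) : ℂ :=
  iteratedDeriv (⌊α⌋₊ + 1) (rlIntegral ((⌊α⌋₊ + 1 : ℕ) - α) f) t

/-- `u` is a (classical) solution for `x, t > 0` of
`D_t^α u = t^m (A x^d u_xx + B x^(d-1) u_x + C x^(d-2) u)`: all the integrals and derivatives in
the equation exist, and the equation holds. -/
structure IsSolution (α : ℝ) (m : ℕ) (d A B C : ℝ) (u : ℝ → ℝ → ℂ) : Prop where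
  integrable : ∀ x > 0, ∀ t > 0, IntervalIntegrable (u x) volume 0 t
  kernel_integrable : ∀ x > 0, ∀ t > 0, IntervalIntegrable
    (fun τ : ℝ => (((t - τ) ^ (((⌊α⌋₊ + 1 : ℕ) : ℝ) - α - 1) : ℝ) : ℂ) * u x τ) volume 0 t
  contDiff_time : ∀ x > 0, ContDiffOn ℝ ((⌊α⌋₊ + 1 : ℕ) : WithTop ℕ∞)
    (rlIntegral ((⌊α⌋₊ + 1 : ℕ) - α) (u x)) (Ioi 0)
  contDiff_space : ∀ t > 0, ContDiffOn ℝ 2 (fun x => u x t) (Ioi 0)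
  equation : ∀ x > 0, ∀ t > 0,
    rlDeriv α (u x) t =
      ((t ^ m : ℝ) : ℂ) *
        (((A * x ^ d : ℝ) : ℂ) * iteratedDeriv 2 (fun y => u y t) x
          + ((B * x ^ (d - 1) : ℝ) : ℂ) * deriv (fun y => u y t) x
          + ((C * x ^ (d - 2) : ℝ) : ℂ) * u x t)

/-! Parameters of the solutions -/

/-- `(α + m) / (2 (2 - d)) * (B / A + 2 a - 1 + r)`; with `r` a square root of
`(1 - B / A)^2 - 4 C / A` this is `s₁`, and with `-r` in place of `r` it is `s₂`. -/
def sRoot (α : ℝ) (m : ℕ) (d A B a : ℝ) (r : ℂ) : ℂ :=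
  (((α + m) / (2 * (2 - d)) : ℝ) : ℂ) * (((B / A + 2 * a - 1 : ℝ) : ℂ) + r)

/-- The lower parameters `-s₁/(α+m), -s₂/(α+m), (j/(α+m))_{j=1,…,m}`. -/
def foxLower (α : ℝ) (m : ℕ) (s₁ s₂ : ℂ) : Fin (m + 2) → ℂ :=
  Matrix.vecCons (-s₁ / ((α + m : ℝ) : ℂ)) (Matrix.vecCons (-s₂ / ((α + m : ℝ) : ℂ))
    (fun j : Fin m => ((((j : ℕ) + 1 : ℝ) / (α + m) : ℝ) : ℂ)))

/-- The upper parameters `((α-k+i)/(α+m))_{i=1,…,m}, 1`. -/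
def wrightUpper (α : ℝ) (m k : ℕ) : Fin (m + 1) → ℂ :=
  Fin.append (fun i : Fin m => (((α - k + ((i : ℕ) + 1 : ℝ)) / (α + m) : ℝ) : ℂ)) ![1]

/-- The upper parameters `(α-k-s₁)/(α+m), (α-k-s₂)/(α+m), ((α-k+i)/(α+m))_{i=1,…,m}, 1`. -/
def wrightUpper₂ (α : ℝ) (m k : ℕ) (s₁ s₂ : ℂ) : Fin (m + 3) → ℂ :=
  Matrix.vecCons ((((α - k : ℝ) : ℂ) - s₁) / ((α + m : ℝ) : ℂ))
    (Matrix.vecCons ((((α - k : ℝ) : ℂ) - s₂) / ((α + m : ℝ) : ℂ)) (wrightUpper α m k))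

end FracDiff

end

/-! Both kinds of solution are superpositions `∫ G x^(q₀ + q₁ s) t^(p₀ + p₁ s) dμ` of products of
powers: the Wright series over the counting measure on `ℕ`, the Fox function over Lebesgue measure
on a vertical line. By the Beta integral, `D^α t^p = Γ(p+1)/Γ(p+1-α) t^(p-α)` for `Re p > -1`, while
the operator in `x` sends `x^q` to `x^(d-2) P(q) x^q` with `P(q) = A q (q-1) + B q + C`. If all
superpositions converge absolutely with polynomial weights in the exponent, these rules may be
applied under the integral (`isSolution_of_superposition`). Both sides then contain the same powers
up to one step of `s`, and the equation becomes a first-order recurrence for the coefficients.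

For `d ≠ 2`, `P(a + (d-2)σ) = A (d-2)² (σ - s₁/(α+m)) (σ - s₂/(α+m))` (`indicial_eq_mul`); for `d =
2` the factor is the constant `K = P(a)`. The shift by `m` left over from `D^α` gives `m` more
linear factors. The functional equation of Gamma solves the recurrence.

For the series the step is `n ↦ n + 1`, and the term `n = 0` on the left is killed by `1/Γ(1-k) =
0`. After `Γ(1+n)` cancels `n!`, the coefficients have `M = m + 2` (or `M = m`) upper Gammas against
`Γ(b + (α+m)n)`; the ratio test needs `M < α + m`, that is `α > 2` (or `α > 0`).

For the integral the step is `s ↦ s - 1`, a contour shift by one unit to the left, away from all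
poles (`integral_mellinKernel_eq`). Gamma decays like `exp(-π|Im s|/2)` up to powers, so the kernel
decays at rate `(π/2)(m + 2 - (α + m))`, which is positive exactly for `α < 2`. -/

noncomputable section

namespace FracDiff

open Filter Topology

/-! ### Differentiation and fractional integration of superpositions of powers. -/

section

variable {Ω : Type*} [MeasurableSpace Ω] {μ : Measure Ω}

/-- All the superpositions `∫ G p^N t^p dμ` of powers of `t > 0` converge absolutely. -/
structure PowerDominated (μ : Measure Ω) (G p : Ω → ℂ) : Prop where
  meas_coeff : AEStronglyMeasurable G μ
  meas_exp : Measurable p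
  integrable : ∀ (N : ℕ) (t : ℝ), 0 < t →
    Integrable (fun ω => ‖G ω‖ * (1 + ‖p ω‖) ^ N * t ^ (p ω).re) μ

/-- The superposition `∫ G t^p dμ` of powers of `t`. -/
def powerIntegral (μ : Measure Ω) (G p : Ω → ℂ) (t : ℝ) : ℂ :=
  ∫ ω, G ω * (t : ℂ) ^ p ω ∂μ

namespace PowerDominated

variable {G p : Ω → ℂ}

theorem measurable_cpow (hp : Measurable p) (t : ℝ) : Measurable fun ω => (t : ℂ) ^ p ω :=
  measurable_const.pow hp

theorem measurable_rpow_re (hp : Measurable p) (t : ℝ) : Measurable fun ω => t ^ (p ω).re :=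
  measurable_const.pow (Complex.measurable_re.comp hp)

theorem integrable_mul_cpow (h : PowerDominated μ G p) {t : ℝ} (ht : 0 < t) :
    Integrable (fun ω => G ω * (t : ℂ) ^ p ω) μ := by
  refine (h.integrable 0 t ht).mono'
    (h.meas_coeff.mul (measurable_cpow h.meas_exp t).aestronglyMeasurable) ?_
  refine Eventually.of_forall fun ω => ?_
  simp [Complex.norm_cpow_eq_rpow_re_of_pos ht]

/-- Changing the coefficient by a factor of polynomial growth and translating the exponent. -/
theorem of_norm_le (h : PowerDominated μ G p) {H : Ω → ℂ} (hH : AEStronglyMeasurable H μ)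
    (c : ℝ) {K : ℝ} {M : ℕ} (hle : ∀ ω, ‖H ω‖ ≤ K * (1 + ‖p ω‖) ^ M * ‖G ω‖) :
    PowerDominated μ H (fun ω => p ω + c) := by
  refine ⟨hH, h.meas_exp.add_const _, fun N t ht => ?_⟩
  refine ((h.integrable (M + N) t ht).const_mul (|K| * (1 + |c|) ^ N * t ^ c)).mono' ?_ ?_
  · refine (hH.norm.mul ?_).mul ?_
    · exact (((h.meas_exp.add_const _).norm.const_add 1).pow_const N).aestronglyMeasurable
    · exact (measurable_rpow_re (h.meas_exp.add_const _) t).aestronglyMeasurable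
  · refine Eventually.of_forall fun ω => ?_
    have h1 : 1 + ‖p ω + c‖ ≤ (1 + |c|) * (1 + ‖p ω‖) := by
      have := norm_add_le (p ω) (c : ℂ)
      rw [Complex.norm_real, Real.norm_eq_abs] at this
      nlinarith [norm_nonneg (p ω), abs_nonneg c, mul_nonneg (abs_nonneg c) (norm_nonneg (p ω))]
    have h2 : ‖H ω‖ ≤ |K| * (1 + ‖p ω‖) ^ M * ‖G ω‖ := (hle ω).trans (by
      gcongr
      exact le_abs_self K)
    rw [Real.norm_of_nonneg (by positivity), Complex.add_re, Complex.ofReal_re, Real.rpow_add ht]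
    calc ‖H ω‖ * (1 + ‖p ω + c‖) ^ N * (t ^ (p ω).re * t ^ c)
        ≤ (|K| * (1 + ‖p ω‖) ^ M * ‖G ω‖) * ((1 + |c|) * (1 + ‖p ω‖)) ^ N
            * (t ^ (p ω).re * t ^ c) := by gcongr
      _ = _ := by rw [mul_pow, pow_add]; ring

theorem mul_exp_sub (h : PowerDominated μ G p) (b c : ℝ) :
    PowerDominated μ (fun ω => G ω * (p ω + b)) (fun ω => p ω + c) := by
  refine h.of_norm_le (K := 1 + |b|) (M := 1)
    (h.meas_coeff.mul (h.meas_exp.add_const _).aestronglyMeasurable) c fun ω => ?_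
  rw [Pi.mul_apply, norm_mul, pow_one, mul_comm]
  gcongr
  have := norm_add_le (p ω) (b : ℂ)
  rw [Complex.norm_real, Real.norm_eq_abs] at this
  nlinarith [norm_nonneg (p ω), abs_nonneg b, mul_nonneg (abs_nonneg b) (norm_nonneg (p ω))]

theorem hasDerivAt (h : PowerDominated μ G p) {t : ℝ} (ht : 0 < t) :
    HasDerivAt (powerIntegral μ G p)
      (powerIntegral μ (fun ω => G ω * p ω) (fun ω => p ω - 1) t) t := by
  have h' : PowerDominated μ (fun ω => G ω * p ω) (fun ω => p ω - 1) := by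
    simpa [sub_eq_add_neg] using h.mul_exp_sub 0 (-1)
  have e1 := h'.integrable 0 (t / 2) (by positivity)
  have e2 := h'.integrable 0 (2 * t) (by positivity)
  refine (hasDerivAt_integral_of_dominated_loc_of_deriv_le (𝕜 := ℝ) (μ := μ)
    (F := fun t ω => G ω * (t : ℂ) ^ p ω)
    (F' := fun t ω => G ω * p ω * (t : ℂ) ^ (p ω - 1))
    (s := Ioo (t / 2) (2 * t)) (Ioo_mem_nhds (by linarith) (by linarith)) ?_
    (h.integrable_mul_cpow ht) (h'.integrable_mul_cpow ht).1 ?_ (e1.add e2) ?_).2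
  · exact Eventually.of_forall fun t =>
      h.meas_coeff.mul (measurable_cpow h.meas_exp t).aestronglyMeasurable
  · refine Eventually.of_forall fun ω τ hτ => ?_
    have hτ0 : 0 < τ := by linarith [hτ.1]
    rw [norm_mul, Complex.norm_cpow_eq_rpow_re_of_pos hτ0]
    simp only [Pi.add_apply, pow_zero, mul_one]
    rw [← mul_add]
    gcongr
    -- A real power is monotone in its base, increasing or decreasing, so the values at `t / 2` and
    -- `2 * t` together dominate it in between.
    rcases le_total 0 (p ω - 1).re with hr | hr
    · exact (Real.rpow_le_rpow hτ0.le hτ.2.le hr).trans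
        (le_add_of_nonneg_left (by positivity))
    · exact (Real.rpow_le_rpow_of_nonpos (by positivity) hτ.1.le hr).trans
        (le_add_of_nonneg_right (by positivity))
  · refine Eventually.of_forall fun ω τ hτ => ?_
    have hτ0 : 0 < τ := by linarith [hτ.1]
    have := ((hasDerivAt_id (τ : ℂ)).cpow_const (c := p ω)
      (Complex.ofReal_mem_slitPlane.2 hτ0)).comp_ofReal
    simpa [mul_assoc] using this.const_mul (G ω)

theorem deriv_eqOn (h : PowerDominated μ G p) :
    EqOn (deriv (powerIntegral μ G p))
      (powerIntegral μ (fun ω => G ω * p ω) (fun ω => p ω - 1)) (Ioi 0) :=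
  fun _ ht => (h.hasDerivAt ht).deriv

theorem contDiffOn (h : PowerDominated μ G p) (n : ℕ) :
    ContDiffOn ℝ n (powerIntegral μ G p) (Ioi 0) := by
  induction n generalizing G p with
  | zero =>
    rw [Nat.cast_zero, contDiffOn_zero]
    exact fun t ht => (h.hasDerivAt ht).continuousAt.continuousWithinAt
  | succ n ih =>
    rw [Nat.cast_succ, contDiffOn_succ_iff_deriv_of_isOpen isOpen_Ioi]
    refine ⟨fun t ht => (h.hasDerivAt ht).differentiableAt.differentiableWithinAt, by simp, ?_⟩
    refine ContDiffOn.congr (ih ?_) h.deriv_eqOn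
    simpa [sub_eq_add_neg] using h.mul_exp_sub 0 (-1)

theorem iteratedDeriv_eq (h : PowerDominated μ G p) (n : ℕ) {t : ℝ} (ht : 0 < t) :
    iteratedDeriv n (powerIntegral μ G p) t =
      powerIntegral μ (fun ω => G ω * ∏ i ∈ Finset.range n, (p ω - i)) (fun ω => p ω - n) t := by
  induction n generalizing G p with
  | zero => simp
  | succ n ih =>
    have h' : PowerDominated μ (fun ω => G ω * p ω) (fun ω => p ω - 1) := by
      simpa [sub_eq_add_neg] using h.mul_exp_sub 0 (-1)
    rw [iteratedDeriv_succ', Filter.EventuallyEq.iteratedDeriv_eq (n := n)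
      (h.deriv_eqOn.eventuallyEq_of_mem (Ioi_mem_nhds ht)), ih h']
    congr 1
    · ext ω
      rw [Finset.prod_range_succ']
      simp only [Nat.cast_zero, sub_zero, Nat.cast_succ, sub_sub, add_comm (1 : ℂ)]
      ring
    · ext ω
      push_cast
      ring

end PowerDominated

theorem ofReal_rpow_mul_cpow_integral {t β : ℝ} (ht : 0 < t) (hβ : 0 < β) {p : ℂ}
    (hp : -1 < p.re) :
    ∫ τ in (0 : ℝ)..t, (((t - τ) ^ (β - 1) : ℝ) : ℂ) * (τ : ℂ) ^ p =
      Complex.Gamma β * (Complex.Gamma (p + 1) / Complex.Gamma (p + 1 + β)) *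
        (t : ℂ) ^ (p + β) := by
  have hre : 0 < (p + 1).re := by simp; linarith
  have h := Complex.betaIntegral_scaled (p + 1) β ht
  have hG := Complex.Gamma_mul_Gamma_eq_betaIntegral hre
    (show 0 < (β : ℂ).re by simpa using hβ)
  have hne : Complex.Gamma (p + 1 + β) ≠ 0 :=
    Complex.Gamma_ne_zero_of_re_pos (by
      rw [Complex.add_re, Complex.ofReal_re]; exact add_pos hre hβ)
  have e : ∫ τ in (0 : ℝ)..t, (((t - τ) ^ (β - 1) : ℝ) : ℂ) * (τ : ℂ) ^ p =
      ∫ τ in (0 : ℝ)..t, (τ : ℂ) ^ (p + 1 - 1) * ((t : ℂ) - τ) ^ ((β : ℂ) - 1) := by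
    refine intervalIntegral.integral_congr fun τ hτ => ?_
    rw [uIcc_of_le ht.le] at hτ
    simp only [add_sub_cancel_right]
    rw [Complex.ofReal_cpow (sub_nonneg.2 hτ.2)]
    push_cast
    ring
  rw [e, h, show p + 1 + (β : ℂ) - 1 = p + β by ring,
    show Complex.betaIntegral (p + 1) β =
      Complex.Gamma β * (Complex.Gamma (p + 1) / Complex.Gamma (p + 1 + β)) by
      field_simp
      linear_combination -hG]
  ring

theorem intervalIntegrable_kernel_mul_rpow {β ρ t : ℝ} (ht : 0 < t) (hβ : 0 < β) (hρ : -1 < ρ) :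
    IntervalIntegrable (fun τ => (t - τ) ^ (β - 1) * τ ^ ρ) volume 0 t := by
  have := (Complex.betaIntegral_convergent (u := ρ + 1) (v := β) (by simp; linarith)
    (by simpa using hβ)).norm
  have h2 := (this.comp_mul_right (c := t⁻¹)).const_mul (t ^ (β - 1) * t ^ ρ)
  simp only [div_inv_eq_mul, zero_mul, one_mul, add_sub_cancel_right] at h2
  refine h2.congr ?_
  rw [uIoc_of_le ht.le]
  intro τ hτ
  have h0 : 0 < τ * t⁻¹ := mul_pos hτ.1 (inv_pos.2 ht)
  have h1 : (0 : ℝ) ≤ 1 - τ * t⁻¹ := by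
    rw [sub_nonneg, ← div_eq_mul_inv, div_le_one ht]
    exact hτ.2
  simp only
  rw [norm_mul, Complex.norm_cpow_eq_rpow_re_of_pos h0, Complex.ofReal_re,
    show (1 : ℂ) - ((τ * t⁻¹ : ℝ) : ℂ) = ((1 - τ * t⁻¹ : ℝ) : ℂ) by push_cast; ring,
    show (β : ℂ) - 1 = ((β - 1 : ℝ) : ℂ) by push_cast; ring, ← Complex.ofReal_cpow h1,
    Complex.norm_real, Real.norm_of_nonneg (Real.rpow_nonneg h1 _),
    show t ^ (β - 1) * t ^ ρ * ((τ * t⁻¹) ^ ρ * (1 - τ * t⁻¹) ^ (β - 1)) =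
      (t ^ (β - 1) * (1 - τ * t⁻¹) ^ (β - 1)) * (t ^ ρ * (τ * t⁻¹) ^ ρ) by ring,
    ← Real.mul_rpow ht.le h1, ← Real.mul_rpow ht.le h0.le]
  congr 2 <;> field_simp

/-- Up to `Γ(β)` the quotient is a Beta integral, and `|τ^p| ≤ τ^ρ` on `(0, 1]`. The bound does not
depend on `p`, so fractional integration preserves domination. -/
theorem norm_Gamma_div_Gamma_le {β ρ : ℝ} (hβ : 0 < β) (hρ : -1 < ρ) {p : ℂ} (hp : ρ ≤ p.re) :
    ‖Complex.Gamma (p + 1) / Complex.Gamma (p + 1 + β)‖ ≤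
      (Real.Gamma β)⁻¹ * ∫ τ in (0 : ℝ)..1, (1 - τ) ^ (β - 1) * τ ^ ρ := by
  have h := ofReal_rpow_mul_cpow_integral one_pos hβ (hρ.trans_le hp)
  have hβ' := Real.Gamma_pos_of_pos hβ
  rw [Complex.ofReal_one, Complex.one_cpow, mul_one, Complex.Gamma_ofReal] at h
  rw [← div_eq_inv_mul, le_div_iff₀ hβ', mul_comm, ← Real.norm_of_nonneg hβ'.le,
    ← Complex.norm_real, ← norm_mul, ← h]
  refine intervalIntegral.norm_integral_le_of_norm_le zero_le_one ?_ ?_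
  · refine Eventually.of_forall fun τ hτ => ?_
    rw [norm_mul, Complex.norm_cpow_eq_rpow_re_of_pos hτ.1, Complex.norm_real,
      Real.norm_of_nonneg (Real.rpow_nonneg (sub_nonneg.2 hτ.2) _)]
    exact mul_le_mul_of_nonneg_left (Real.rpow_le_rpow_of_exponent_ge hτ.1 hτ.2 hp)
      (Real.rpow_nonneg (sub_nonneg.2 hτ.2) _)
  · exact intervalIntegrable_kernel_mul_rpow one_pos hβ hρ

variable {G p : Ω → ℂ}

namespace PowerDominated

variable {ρ β : ℝ}

/-- The coefficient of the fractional integral of a superposition of powers. -/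
theorem mul_Gamma_div_Gamma (h : PowerDominated μ G p) (hβ : 0 < β) (hρ : -1 < ρ)
    (hp : ∀ ω, G ω ≠ 0 → ρ ≤ (p ω).re) :
    PowerDominated μ
      (fun ω => G ω * (Complex.Gamma (p ω + 1) / Complex.Gamma (p ω + 1 + β)))
      (fun ω => p ω + β) := by
  -- Gamma is the pointwise inverse of an entire function, also at its poles, where both have the
  -- value 0.
  have hm : Measurable Complex.Gamma := by
    have h1 : Measurable fun s : ℂ => (Complex.Gamma s)⁻¹ :=
      Complex.differentiable_one_div_Gamma.continuous.measurable
    have h2 := h1.inv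
    rwa [show (fun s : ℂ => (Complex.Gamma s)⁻¹)⁻¹ = Complex.Gamma by ext; simp] at h2
  refine h.of_norm_le (M := 0) (K := (Real.Gamma β)⁻¹ *
    ∫ τ in (0 : ℝ)..1, (1 - τ) ^ (β - 1) * τ ^ ρ) (h.meas_coeff.mul ?_) β fun ω => ?_
  · exact ((hm.comp (h.meas_exp.add_const 1)).div
      (hm.comp ((h.meas_exp.add_const 1).add_const _))).aestronglyMeasurable
  · by_cases h0 : G ω = 0
    · simp [h0]
    · rw [pow_zero, mul_one, Pi.mul_apply, norm_mul, mul_comm]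
      exact mul_le_mul_of_nonneg_right (norm_Gamma_div_Gamma_le hβ hρ (hp ω h0)) (norm_nonneg _)

/-- The hypothesis of Fubini's theorem: `τ^(Re p) ≤ τ^ρ t^(Re p - ρ)` for `0 < τ ≤ t` gives a
majorant that is a product of a function of `τ` and a function of `ω`. -/
theorem integrable_kernel_prod (h : PowerDominated μ G p) (hβ : 0 < β) (hρ : -1 < ρ)
    (hp : ∀ ω, G ω ≠ 0 → ρ ≤ (p ω).re) {t : ℝ} (ht : 0 < t) :
    Integrable (fun z : ℝ × Ω => (((t - z.1) ^ (β - 1) : ℝ) : ℂ) * (G z.2 * (z.1 : ℂ) ^ p z.2))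
      ((volume.restrict (Ioc 0 t)).prod μ) := by
  have h1 : Integrable (fun τ => (t - τ) ^ (β - 1) * τ ^ ρ) (volume.restrict (Ioc 0 t)) :=
    (intervalIntegrable_iff_integrableOn_Ioc_of_le ht.le).1
      (intervalIntegrable_kernel_mul_rpow ht hβ hρ)
  have h2 := (h.integrable 0 t ht).mul_const (t ^ (-ρ))
  refine (h1.mul_prod h2).mono' ?_ ?_
  · refine AEStronglyMeasurable.mul ?_ (h.meas_coeff.comp_snd.mul ?_)
    · exact (Complex.measurable_ofReal.comp
        ((measurable_const.sub measurable_fst).pow_const _)).aestronglyMeasurable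
    · exact ((Complex.measurable_ofReal.comp measurable_fst).pow
        (h.meas_exp.comp measurable_snd)).aestronglyMeasurable
  · have : ∀ᵐ z : ℝ × Ω ∂((volume.restrict (Ioc 0 t)).prod μ), z.1 ∈ Ioc 0 t :=
      Measure.quasiMeasurePreserving_fst.ae (ae_restrict_mem measurableSet_Ioc)
    filter_upwards [this] with z hz
    have hk : 0 ≤ (t - z.1) ^ (β - 1) := Real.rpow_nonneg (sub_nonneg.2 hz.2) _
    rw [norm_mul, norm_mul, Complex.norm_real, Real.norm_of_nonneg hk,
      Complex.norm_cpow_eq_rpow_re_of_pos hz.1, pow_zero, mul_one]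
    by_cases h0 : G z.2 = 0
    · simp [h0]
    · have key : z.1 ^ (p z.2).re ≤ z.1 ^ ρ * (t ^ (p z.2).re * t ^ (-ρ)) := by
        rw [← Real.rpow_add ht, show (p z.2).re = ρ + ((p z.2).re + -ρ) by ring,
          Real.rpow_add hz.1]
        have := hp z.2 h0
        refine mul_le_mul_of_nonneg_left ?_ (Real.rpow_nonneg hz.1.le _)
        rw [show ρ + ((p z.2).re + -ρ) + -ρ = (p z.2).re + -ρ by ring]
        exact Real.rpow_le_rpow hz.1.le hz.2 (by linarith)
      calc (t - z.1) ^ (β - 1) * (‖G z.2‖ * z.1 ^ (p z.2).re)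
          ≤ (t - z.1) ^ (β - 1) *
              (‖G z.2‖ * (z.1 ^ ρ * (t ^ (p z.2).re * t ^ (-ρ)))) := by gcongr
        _ = _ := by ring

variable [SFinite μ]

theorem intervalIntegrable_kernel (h : PowerDominated μ G p) (hβ : 0 < β) (hρ : -1 < ρ)
    (hp : ∀ ω, G ω ≠ 0 → ρ ≤ (p ω).re) {t : ℝ} (ht : 0 < t) :
    IntervalIntegrable (fun τ => (((t - τ) ^ (β - 1) : ℝ) : ℂ) * powerIntegral μ G p τ)
      volume 0 t := by
  rw [intervalIntegrable_iff_integrableOn_Ioc_of_le ht.le]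
  refine (h.integrable_kernel_prod hβ hρ hp ht).integral_prod_left.congr ?_
  refine Eventually.of_forall fun τ => ?_
  simp only [powerIntegral]
  rw [← integral_const_mul]

theorem rlIntegral_eq (h : PowerDominated μ G p) (hβ : 0 < β) (hρ : -1 < ρ)
    (hp : ∀ ω, G ω ≠ 0 → ρ ≤ (p ω).re) {t : ℝ} (ht : 0 < t) :
    rlIntegral β (powerIntegral μ G p) t = powerIntegral μ
      (fun ω => G ω * (Complex.Gamma (p ω + 1) / Complex.Gamma (p ω + 1 + β)))
      (fun ω => p ω + β) t := by
  have hΓ : Complex.Gamma β ≠ 0 := Complex.Gamma_ne_zero_of_re_pos (by simpa using hβ)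
  rw [rlIntegral, ← Complex.Gamma_ofReal, inv_mul_eq_iff_eq_mul₀ hΓ,
    intervalIntegral.integral_of_le ht.le]
  simp_rw [powerIntegral, ← integral_const_mul]
  rw [integral_integral_swap (h.integrable_kernel_prod hβ hρ hp ht)]
  refine integral_congr_ae (Eventually.of_forall fun ω => ?_)
  simp only
  by_cases h0 : G ω = 0
  · simp [h0]
  · have := ofReal_rpow_mul_cpow_integral ht hβ (hρ.trans_le (hp ω h0))
    rw [intervalIntegral.integral_of_le ht.le] at this
    simp_rw [mul_left_comm _ (G ω)]
    rw [integral_const_mul, this]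
    ring

end PowerDominated

end

/-! ### Reduction of the equation to an identity between superpositions. -/

section

variable {Ω : Type*} [MeasurableSpace Ω] {μ : Measure Ω} {G s : Ω → ℂ}

/-- Since `|x^(q₁ s) t^(p₁ s)| = (x^q₁ t^p₁)^(Re s)`, domination for every base covers both
variables at once. -/
theorem PowerDominated.affine (h : PowerDominated μ G s) (q₀ q₁ p₀ p₁ : ℝ) {x : ℝ} (hx : 0 < x) :
    PowerDominated μ (fun ω => G ω * (x : ℂ) ^ ((q₀ : ℂ) + q₁ * s ω))
      (fun ω => (p₀ : ℂ) + p₁ * s ω) := by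
  have hq : Measurable fun ω => (q₀ : ℂ) + q₁ * s ω := (h.meas_exp.const_mul _).const_add _
  have hp : Measurable fun ω => (p₀ : ℂ) + p₁ * s ω := (h.meas_exp.const_mul _).const_add _
  have hm : AEStronglyMeasurable (fun ω => G ω * (x : ℂ) ^ ((q₀ : ℂ) + q₁ * s ω)) μ :=
    h.meas_coeff.mul (PowerDominated.measurable_cpow hq x).aestronglyMeasurable
  refine ⟨hm, hp, fun N t ht => ?_⟩
  refine ((h.integrable N (x ^ q₁ * t ^ p₁) (by positivity)).const_mul
    (x ^ q₀ * t ^ p₀ * (1 + |p₀| + |p₁|) ^ N)).mono' ?_ (Eventually.of_forall fun ω => ?_)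
  · refine (hm.norm.mul ?_).mul ?_
    · exact ((hp.norm.const_add 1).pow_const N).aestronglyMeasurable
    · exact (PowerDominated.measurable_rpow_re hp t).aestronglyMeasurable
  · have h1 : 1 + ‖(p₀ : ℂ) + p₁ * s ω‖ ≤ (1 + |p₀| + |p₁|) * (1 + ‖s ω‖) := by
      have := norm_add_le (p₀ : ℂ) (p₁ * s ω)
      rw [norm_mul, Complex.norm_real, Complex.norm_real, Real.norm_eq_abs, Real.norm_eq_abs]
        at this
      nlinarith [norm_nonneg (s ω), abs_nonneg p₀, abs_nonneg p₁,
        mul_nonneg (abs_nonneg p₀) (norm_nonneg (s ω))]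
    rw [Real.norm_of_nonneg (by positivity), norm_mul, Complex.norm_cpow_eq_rpow_re_of_pos hx,
      Real.mul_rpow (by positivity) (by positivity), ← Real.rpow_mul hx.le, ← Real.rpow_mul ht.le]
    simp only [Complex.add_re, Complex.ofReal_re, Complex.re_ofReal_mul]
    rw [Real.rpow_add hx, Real.rpow_add ht]
    calc ‖G ω‖ * (x ^ q₀ * x ^ (q₁ * (s ω).re)) * (1 + ‖(p₀ : ℂ) + p₁ * s ω‖) ^ N
          * (t ^ p₀ * t ^ (p₁ * (s ω).re))
        ≤ ‖G ω‖ * (x ^ q₀ * x ^ (q₁ * (s ω).re)) * ((1 + |p₀| + |p₁|) * (1 + ‖s ω‖)) ^ N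
          * (t ^ p₀ * t ^ (p₁ * (s ω).re)) := by gcongr
      _ = _ := by rw [mul_pow]; ring

/-- In reciprocal form the functional equation needs no exclusion of poles. -/
theorem inv_Gamma_eq_prod_mul (n : ℕ) (w : ℂ) :
    (Complex.Gamma w)⁻¹ = (∏ i ∈ Finset.range n, (w + i)) * (Complex.Gamma (w + n))⁻¹ := by
  induction n with
  | zero => simp
  | succ n ih =>
    have := Complex.one_div_Gamma_eq_self_mul_one_div_Gamma_add_one (w + n)
    rw [ih, this, Finset.prod_range_succ]
    push_cast
    ring_nf

theorem rlIntegral_congr {β : ℝ} {f g : ℝ → ℂ} (h : EqOn f g (Ioi 0)) {t : ℝ} (ht : 0 < t) :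
    rlIntegral β f t = rlIntegral β g t := by
  unfold rlIntegral
  rw [intervalIntegral.integral_of_le ht.le, intervalIntegral.integral_of_le ht.le]
  congr 1
  exact setIntegral_congr_fun measurableSet_Ioc fun τ hτ => by rw [h hτ.1]

/-- The product produced by differentiating `t^(p + n - α)` `n` times turns `1/Γ(p + 1 + n - α)`
into `1/Γ(p + 1 - α)`. The differentiation product descends and the Gamma product ascends, hence the
reflection of the range. -/
theorem PowerDominated.rlDeriv_eq [SFinite μ] {p : Ω → ℂ} (h : PowerDominated μ G p)
    {α ρ : ℝ} (hρ : -1 < ρ) (hp : ∀ ω, G ω ≠ 0 → ρ ≤ (p ω).re) {t : ℝ} (ht : 0 < t) :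
    rlDeriv α (powerIntegral μ G p) t = powerIntegral μ
      (fun ω => G ω * (Complex.Gamma (p ω + 1) * (Complex.Gamma (p ω + 1 - α))⁻¹))
      (fun ω => p ω - α) t := by
  have hβ : 0 < ((⌊α⌋₊ + 1 : ℕ) : ℝ) - α := by
    push_cast
    linarith [Nat.lt_floor_add_one α]
  have e : rlIntegral (((⌊α⌋₊ + 1 : ℕ) : ℝ) - α) (powerIntegral μ G p) =ᶠ[𝓝 t] _ :=
    eventuallyEq_of_mem (Ioi_mem_nhds ht) fun τ hτ => h.rlIntegral_eq hβ hρ hp hτ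
  rw [rlDeriv, e.iteratedDeriv_eq, (h.mul_Gamma_div_Gamma hβ hρ hp).iteratedDeriv_eq _ ht]
  generalize ⌊α⌋₊ + 1 = n
  congr 1
  · ext ω
    rw [inv_Gamma_eq_prod_mul n, ← Finset.prod_range_reflect (fun i : ℕ => p ω + 1 - α + (i : ℂ)),
      div_eq_mul_inv]
    have : ∏ i ∈ Finset.range n, (p ω + ((n : ℝ) - α : ℝ) - i) =
        ∏ j ∈ Finset.range n, (p ω + 1 - α + ((n - 1 - j : ℕ) : ℂ)) := by
      refine Finset.prod_congr rfl fun i hi => ?_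
      have hi := Finset.mem_range.1 hi
      rw [Nat.sub_sub, Nat.cast_sub (by omega)]
      push_cast
      ring
    rw [this, show p ω + 1 + (((n : ℝ) - α : ℝ) : ℂ) = p ω + 1 - α + n by push_cast; ring]
    ring
  · ext ω
    push_cast
    ring

/-- A superposition of the products `x^(q₀ + q₁ s) t^(p₀ + p₁ s)` is a solution if the
superpositions that arise from the two sides of the equation agree. -/
theorem isSolution_of_superposition [SFinite μ] {α : ℝ} {m : ℕ} {d A B C q₀ q₁ p₀ p₁ ρ : ℝ}
    (h : PowerDominated μ G s) (hρ : -1 < ρ) (hp : ∀ ω, G ω ≠ 0 → ρ ≤ p₀ + p₁ * (s ω).re)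
    {u : ℝ → ℝ → ℂ}
    (hu : ∀ x : ℝ, 0 < x → ∀ t : ℝ, 0 < t → u x t =
      ∫ ω, G ω * (x : ℂ) ^ ((q₀ : ℂ) + q₁ * s ω) * (t : ℂ) ^ ((p₀ : ℂ) + p₁ * s ω) ∂μ)
    (heq : ∀ x : ℝ, 0 < x → ∀ t : ℝ, 0 < t →
      ∫ ω, G ω * (x : ℂ) ^ ((q₀ : ℂ) + q₁ * s ω) *
        (Complex.Gamma ((p₀ : ℂ) + p₁ * s ω + 1) * (Complex.Gamma (p₀ + p₁ * s ω + 1 - α))⁻¹) *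
          (t : ℂ) ^ ((p₀ : ℂ) + p₁ * s ω - α) ∂μ =
      ((t ^ m * x ^ (d - 2) : ℝ) : ℂ) * ∫ ω, G ω * (x : ℂ) ^ ((q₀ : ℂ) + q₁ * s ω) *
        (t : ℂ) ^ ((p₀ : ℂ) + p₁ * s ω) *
          (A * (q₀ + q₁ * s ω) * (q₀ + q₁ * s ω - 1) + B * (q₀ + q₁ * s ω) + C) ∂μ) :
    IsSolution α m d A B C u := by
  have hT {x : ℝ} (hx : 0 < x) := h.affine q₀ q₁ p₀ p₁ hx
  have hX {t : ℝ} (ht : 0 < t) := h.affine p₀ p₁ q₀ q₁ ht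
  have hp' (x : ℝ) (ω : Ω) (h0 : G ω * (x : ℂ) ^ ((q₀ : ℂ) + q₁ * s ω) ≠ 0) :
      ρ ≤ ((p₀ : ℂ) + p₁ * s ω).re := by
    simpa using hp ω (left_ne_zero_of_mul h0)
  have huT {x : ℝ} (hx : 0 < x) : EqOn (u x) (powerIntegral μ
      (fun ω => G ω * (x : ℂ) ^ ((q₀ : ℂ) + q₁ * s ω)) (fun ω => (p₀ : ℂ) + p₁ * s ω)) (Ioi 0) :=
    fun t ht => hu x hx t ht
  have huX {t : ℝ} (ht : 0 < t) : EqOn (fun x => u x t) (powerIntegral μ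
      (fun ω => G ω * (t : ℂ) ^ ((p₀ : ℂ) + p₁ * s ω)) (fun ω => (q₀ : ℂ) + q₁ * s ω)) (Ioi 0) :=
    fun x hx => (hu x hx t ht).trans (integral_congr_ae (Eventually.of_forall fun ω => by
      simp only; ring))
  have hβ : 0 < ((⌊α⌋₊ + 1 : ℕ) : ℝ) - α := by
    push_cast
    linarith [Nat.lt_floor_add_one α]
  have hker {β : ℝ} (hβ : 0 < β) {x : ℝ} (hx : 0 < x) {t : ℝ} (ht : 0 < t) : IntervalIntegrable
      (fun τ => (((t - τ) ^ (β - 1) : ℝ) : ℂ) * u x τ) volume 0 t := by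
    refine ((hT hx).intervalIntegrable_kernel hβ hρ (hp' x) ht).congr ?_
    rw [uIoc_of_le ht.le]
    intro τ hτ
    simp only
    rw [huT hx hτ.1]
  refine ⟨fun x hx t ht => ?_, fun x hx t ht => hker hβ hx ht, fun x hx => ?_, fun t ht => ?_,
    fun x hx t ht => ?_⟩
  -- For `β = 1` the kernel is 1.
  · simpa using hker one_pos hx ht
  · refine (((hT hx).mul_Gamma_div_Gamma hβ hρ (hp' x)).contDiffOn (⌊α⌋₊ + 1)).congr
      fun t ht => ?_
    rw [rlIntegral_congr (huT hx) ht]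
    exact (hT hx).rlIntegral_eq hβ hρ (hp' x) ht
  · exact ((hX ht).contDiffOn 2).congr (huX ht)
  · have ex : (fun x => u x t) =ᶠ[𝓝 x] _ := eventuallyEq_of_mem (Ioi_mem_nhds hx) (huX ht)
    have eD : rlDeriv α (u x) t = rlDeriv α (powerIntegral μ _ _) t :=
      Filter.EventuallyEq.iteratedDeriv_eq _ (eventuallyEq_of_mem (Ioi_mem_nhds ht)
        fun τ hτ => rlIntegral_congr (huT hx) hτ)
    have hxc : (x : ℂ) ≠ 0 := by exact_mod_cast hx.ne'
    have i1 := ((hX ht).mul_exp_sub 0 (-1)).integrable_mul_cpow hx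
    have i2 := (((hX ht).mul_exp_sub 0 (-1)).mul_exp_sub 0 (-1)).integrable_mul_cpow hx
    have j2 : Integrable (fun ω => ((A * x ^ d : ℝ) : ℂ) * (G ω * (t : ℂ) ^ ((p₀ : ℂ) + p₁ * s ω) *
        (∏ i ∈ Finset.range 2, ((q₀ : ℂ) + q₁ * s ω - (i : ℕ))) *
          (x : ℂ) ^ ((q₀ : ℂ) + q₁ * s ω - (2 : ℕ)))) μ := by
      refine (i2.const_mul ((A * x ^ d : ℝ) : ℂ)).congr (Eventually.of_forall fun ω => ?_)
      simp only [Finset.prod_range_succ, Finset.prod_range_zero]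
      push_cast
      ring_nf
    have j1 : Integrable (fun ω => ((B * x ^ (d - 1) : ℝ) : ℂ) *
        (G ω * (t : ℂ) ^ ((p₀ : ℂ) + p₁ * s ω) * ((q₀ : ℂ) + q₁ * s ω) *
          (x : ℂ) ^ ((q₀ : ℂ) + q₁ * s ω - 1))) μ := by
      refine (i1.const_mul ((B * x ^ (d - 1) : ℝ) : ℂ)).congr (Eventually.of_forall fun ω => ?_)
      simp only
      push_cast
      ring_nf
    have j0 := ((hX ht).integrable_mul_cpow hx).const_mul ((C * x ^ (d - 2) : ℝ) : ℂ)
    rw [eD, (hT hx).rlDeriv_eq hρ (hp' x) ht, ex.iteratedDeriv_eq, ex.deriv_eq,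
      show u x t = _ from huX ht hx, (hX ht).iteratedDeriv_eq 2 hx, ((hX ht).hasDerivAt hx).deriv,
      powerIntegral, heq x hx t ht]
    simp only [powerIntegral]
    rw [← integral_const_mul, ← integral_const_mul, ← integral_const_mul, ← integral_const_mul,
      ← integral_add, ← integral_add, ← integral_const_mul]
    · refine integral_congr_ae (Eventually.of_forall fun ω => ?_)
      simp only [Finset.prod_range_succ, Finset.prod_range_zero]
      rw [Complex.cpow_sub _ _ hxc, Complex.cpow_sub _ _ hxc, Complex.cpow_natCast,
        Complex.cpow_one, Real.rpow_sub hx, Real.rpow_sub hx, Real.rpow_one, Real.rpow_two]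
      push_cast
      field_simp
      ring
    all_goals first | exact j0 | exact j1 | exact j2 | exact j2.add j1

end

/-! ### Linearity of the equation. -/

section

variable {α : ℝ} {m : ℕ} {d A B C : ℝ}

theorem rlIntegral_zero (β : ℝ) : rlIntegral β (fun _ => 0) = fun _ => 0 := by
  ext t
  simp [rlIntegral]

theorem isSolution_zero : IsSolution α m d A B C (fun _ _ => 0) where
  integrable _ _ _ _ := by simp
  kernel_integrable _ _ _ _ := by simp
  contDiff_time _ _ := by
    simpa only [rlIntegral_zero] using contDiffOn_const
  contDiff_space _ _ := contDiffOn_const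
  equation x _ t _ := by
    simp [rlDeriv, rlIntegral_zero]

theorem IsSolution.add {u v : ℝ → ℝ → ℂ} (hu : IsSolution α m d A B C u)
    (hv : IsSolution α m d A B C v) : IsSolution α m d A B C (fun x t => u x t + v x t) := by
  have hI : ∀ x > 0, EqOn (rlIntegral ((⌊α⌋₊ + 1 : ℕ) - α) (fun t => u x t + v x t))
      (rlIntegral ((⌊α⌋₊ + 1 : ℕ) - α) (u x) + rlIntegral ((⌊α⌋₊ + 1 : ℕ) - α) (v x)) (Ioi 0) := by
    intro x hx t ht
    simp only [rlIntegral, Pi.add_apply, mul_add]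
    rw [← mul_add, ← intervalIntegral.integral_add (hu.kernel_integrable x hx t ht)
      (hv.kernel_integrable x hx t ht)]
  refine ⟨fun x hx t ht => (hu.integrable x hx t ht).add (hv.integrable x hx t ht),
    fun x hx t ht => ?_, fun x hx => ?_,
    fun t ht => (hu.contDiff_space t ht).add (hv.contDiff_space t ht), fun x hx t ht => ?_⟩
  · simpa only [mul_add] using
      (hu.kernel_integrable x hx t ht).add (hv.kernel_integrable x hx t ht)
  · exact ((hu.contDiff_time x hx).add (hv.contDiff_time x hx)).congr (hI x hx)
  · have ux := (hu.contDiff_space t ht).contDiffAt (Ioi_mem_nhds hx)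
    have vx := (hv.contDiff_space t ht).contDiffAt (Ioi_mem_nhds hx)
    have e : rlDeriv α (fun t => u x t + v x t) t = rlDeriv α (u x) t + rlDeriv α (v x) t := by
      rw [rlDeriv, ((hI x hx).eventuallyEq_of_mem (Ioi_mem_nhds ht)).iteratedDeriv_eq,
        iteratedDeriv_add ((hu.contDiff_time x hx).contDiffAt (Ioi_mem_nhds ht))
          ((hv.contDiff_time x hx).contDiffAt (Ioi_mem_nhds ht))]
      rfl
    have e2 := iteratedDeriv_fun_add (n := 2) ux vx
    have e1 := deriv_fun_add (ux.differentiableAt (by simp)) (vx.differentiableAt (by simp))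
    rw [e, e2, e1, hu.equation x hx t ht, hv.equation x hx t ht]
    ring

theorem isSolution_sum {ι : Type*} (S : Finset ι) {u : ι → ℝ → ℝ → ℂ}
    (h : ∀ k ∈ S, IsSolution α m d A B C (u k)) :
    IsSolution α m d A B C (fun x t => ∑ k ∈ S, u k x t) := by
  classical
  induction S using Finset.induction_on with
  | empty => simpa using isSolution_zero
  | insert k S hk ih =>
    simp only [Finset.sum_insert hk]
    exact (h k (by simp)).add (ih fun j hj => h j (by simp [hj]))

end

/-! ### Growth of Gamma quotients and convergence of Wright series. -/

section

theorem Gamma_mul_pow_le {x y : ℝ} (hx : 0 ≤ x) (hxy : x ≤ y) (hy : 0 < y) (M : ℕ) :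
    Real.Gamma y * x ^ M ≤ Real.Gamma (y + M) := by
  induction M with
  | zero => simp
  | succ M ih =>
    have h0 : 0 < y + M := by positivity
    rw [Nat.cast_succ, ← add_assoc, Real.Gamma_add_one h0.ne', pow_succ, ← mul_assoc, mul_comm]
    have : x ≤ y + M := hxy.trans (le_add_of_nonneg_right (Nat.cast_nonneg M))
    have := Real.Gamma_pos_of_pos hy
    gcongr

/-- Log-convexity of Gamma at `x + 1 = δ (x + δ) + (1 - δ) (x + δ + 1)` gives `x Γ(x) ≤ (x + δ)^(1 -
δ) Γ(x + δ)`, and `x + δ ≤ 2 x`. -/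
theorem Gamma_le_Gamma_add_mul {x δ : ℝ} (hx : 1 ≤ x) (hδ : 0 < δ) (hδ1 : δ < 1) :
    Real.Gamma x ≤ Real.Gamma (x + δ) * (2 * x ^ (-δ)) := by
  have hx0 : 0 < x := by linarith
  have hg := Real.Gamma_pos_of_pos (show 0 < x + δ by positivity)
  have h := Real.Gamma_mul_add_mul_le_rpow_Gamma_mul_rpow_Gamma (s := x + δ) (t := x + δ + 1)
    (a := δ) (b := 1 - δ) (by positivity) (by positivity) hδ (by linarith) (by ring)
  rw [show δ * (x + δ) + (1 - δ) * (x + δ + 1) = x + 1 by ring, Real.Gamma_add_one hx0.ne',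
    Real.Gamma_add_one (by positivity), Real.mul_rpow (by positivity) hg.le, mul_left_comm,
    ← Real.rpow_add hg, add_sub_cancel, Real.rpow_one] at h
  have h2 : (x + δ) ^ (1 - δ) ≤ 2 * x ^ (1 - δ) := by
    calc (x + δ) ^ (1 - δ) ≤ (2 * x) ^ (1 - δ) :=
          Real.rpow_le_rpow (by positivity) (by linarith) (by linarith)
      _ = 2 ^ (1 - δ) * x ^ (1 - δ) := Real.mul_rpow (by norm_num) hx0.le
      _ ≤ 2 * x ^ (1 - δ) := by
          gcongr
          calc (2 : ℝ) ^ (1 - δ) ≤ 2 ^ (1 : ℝ) :=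
                Real.rpow_le_rpow_of_exponent_le (by norm_num) (by linarith)
            _ = 2 := Real.rpow_one 2
  rw [sub_eq_add_neg, Real.rpow_add hx0, Real.rpow_one] at h2
  rw [← sub_eq_add_neg] at h2
  refine le_of_mul_le_mul_left (h.trans ?_) hx0
  calc (x + δ) ^ (1 - δ) * Real.Gamma (x + δ) ≤ 2 * (x * x ^ (-δ)) * Real.Gamma (x + δ) := by
        gcongr
    _ = _ := by ring

theorem tendsto_Gamma_div_Gamma_add {δ : ℝ} (hδ : 0 < δ) :
    Tendsto (fun x => Real.Gamma x / Real.Gamma (x + δ)) atTop (𝓝 0) := by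
  -- The increment is truncated to stay below 1; monotonicity of Gamma on `[2, ∞)` restores `δ`.
  have hε : 0 < min δ (1 / 2) := by positivity
  have h := ((tendsto_rpow_neg_atTop hε).const_mul 2)
  rw [mul_zero] at h
  refine tendsto_of_tendsto_of_tendsto_of_le_of_le' tendsto_const_nhds h ?_ ?_
  · filter_upwards [eventually_gt_atTop 0] with x hx
    exact div_nonneg (Real.Gamma_pos_of_pos hx).le (Real.Gamma_pos_of_pos (by positivity)).le
  · filter_upwards [eventually_ge_atTop 2] with x hx
    have hpos := Real.Gamma_pos_of_pos (show 0 < x + δ by linarith)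
    rw [div_le_iff₀ hpos]
    refine (Gamma_le_Gamma_add_mul (by linarith) hε
      (lt_of_le_of_lt (min_le_right _ _) (by norm_num))).trans ?_
    rw [mul_comm]
    gcongr
    refine Real.Gamma_strictMonoOn_Ici.monotoneOn ?_ ?_ ?_
    · simp only [mem_Ici]; linarith
    · simp only [mem_Ici]; linarith
    · have := min_le_left δ (1 / 2)
      linarith

/-- The coefficients of a Wright series with a factor `n!` cancelled. -/
def wrightCoeff {M : ℕ} (a : Fin M → ℂ) (b w : ℝ) (n : ℕ) : ℂ :=
  (∏ i, Complex.Gamma (a i + n)) / Complex.Gamma (b + w * n)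

variable {M : ℕ} {a : Fin M → ℂ} {b w : ℝ}

/-- Of the increment `w` of the Gamma argument, `M` units absorb the `M` linear factors, each
comparable to `b + w n`; the remaining `w - M > 0` makes the quotient tend to 0. -/
theorem tendsto_prod_mul_Gamma_div_Gamma (a : Fin M → ℂ) (b : ℝ) (hw : (M : ℝ) < w) :
    Tendsto (fun n : ℕ => ‖∏ i, (a i + n)‖ *
      (Real.Gamma (b + w * n) / Real.Gamma (b + w * (n + 1)))) atTop (𝓝 0) := by
  have hw0 : 0 < w := lt_of_le_of_lt (Nat.cast_nonneg M) hw
  have hx : Tendsto (fun n : ℕ => b + w * n) atTop atTop :=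
    tendsto_atTop_add_const_left _ _ (tendsto_natCast_atTop_atTop.const_mul_atTop hw0)
  have hG := (tendsto_Gamma_div_Gamma_add (sub_pos.2 hw)).comp hx
  have hone : ∀ i, Tendsto (fun n : ℕ => (‖a i‖ + n) / (b + w * n)) atTop (𝓝 (1 / w)) := by
    intro i
    have h1 : Tendsto (fun n : ℕ => (‖a i‖ * (n : ℝ)⁻¹ + 1) / (b * (n : ℝ)⁻¹ + w)) atTop
        (𝓝 ((‖a i‖ * 0 + 1) / (b * 0 + w))) := by
      have h0 := tendsto_inv_atTop_nhds_zero_nat (𝕜 := ℝ)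
      exact ((h0.const_mul _).add_const 1).div ((h0.const_mul _).add_const w) (by simp [hw0.ne'])
    simp only [mul_zero, zero_add] at h1
    refine h1.congr' ?_
    filter_upwards [eventually_gt_atTop 0] with n hn
    have hn : (n : ℝ) ≠ 0 := by exact_mod_cast hn.ne'
    rw [← mul_div_mul_right _ _ hn]
    congr 1 <;> field_simp
  have hP := tendsto_finsetProd Finset.univ fun i _ => hone i
  have hlim := hP.mul hG
  rw [mul_zero] at hlim
  refine tendsto_of_tendsto_of_tendsto_of_le_of_le' tendsto_const_nhds hlim ?_ ?_
  · filter_upwards [hx.eventually_gt_atTop 0] with n hn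
    have h1 := Real.Gamma_pos_of_pos hn
    have h2 := Real.Gamma_pos_of_pos (show 0 < b + w * (n + 1) by linarith)
    positivity
  · filter_upwards [hx.eventually_gt_atTop 0] with n hn
    have hδ := sub_pos.2 hw
    have h1 := Real.Gamma_pos_of_pos hn
    have h3 := Real.Gamma_pos_of_pos (show 0 < b + w * n + (w - M) by linarith)
    have h2 := Gamma_mul_pow_le hn.le (show b + w * n ≤ b + w * n + (w - M) by linarith)
      (by linarith) M
    rw [show b + w * n + (w - M) + M = b + w * (n + 1) by ring] at h2
    rw [Finset.prod_div_distrib, Finset.prod_const, Finset.card_univ, Fintype.card_fin,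
      Function.comp_apply, div_mul_div_comm, norm_prod, ← mul_div_assoc,
      mul_comm ((b + w * n) ^ M)]
    have h4 : ∏ i, ‖a i + n‖ ≤ ∏ i, (‖a i‖ + n) :=
      Finset.prod_le_prod (fun i _ => norm_nonneg _) fun i _ => by
        simpa using norm_add_le (a i) (n : ℂ)
    have h5 : 0 ≤ ∏ i, (‖a i‖ + (n : ℝ)) := Finset.prod_nonneg fun i _ => by positivity
    gcongr

theorem wrightCoeff_succ {n : ℕ} (ha : ∀ i, a i + n ≠ 0) (hb : 0 < b + w * n)
    (hw : 0 < w) : wrightCoeff a b w (n + 1) =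
      (∏ i, (a i + n)) * (Real.Gamma (b + w * n) / Real.Gamma (b + w * (n + 1)) : ℝ) *
        wrightCoeff a b w n := by
  have e : ∀ i, Complex.Gamma (a i + (n + 1 : ℕ)) = (a i + n) * Complex.Gamma (a i + n) :=
    fun i => by rw [← Complex.Gamma_add_one _ (ha i)]; push_cast; ring_nf
  have h1 : Complex.Gamma (b + w * n) ≠ 0 := Complex.Gamma_ne_zero_of_re_pos (by simpa using hb)
  have h2 : Complex.Gamma (b + w * (n + 1)) ≠ 0 := Complex.Gamma_ne_zero_of_re_pos (by
    simp
    linarith)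
  simp only [wrightCoeff, e, Finset.prod_mul_distrib, Complex.ofReal_div, ← Complex.Gamma_ofReal]
  push_cast
  generalize Complex.Gamma (b + w * n) = g₁ at *
  generalize Complex.Gamma (b + w * (n + 1)) = g₂ at *
  field_simp

theorem summable_wrightCoeff (ha : ∀ i (n : ℕ), a i + n ≠ 0) (hw : (M : ℝ) < w) (N : ℕ) (z : ℂ) :
    Summable fun n : ℕ => ‖wrightCoeff a b w n‖ * (1 + (n : ℝ)) ^ N * ‖z‖ ^ n := by
  have hw0 : 0 < w := lt_of_le_of_lt (Nat.cast_nonneg M) hw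
  have hx : Tendsto (fun n : ℕ => b + w * n) atTop atTop :=
    tendsto_atTop_add_const_left _ _ (tendsto_natCast_atTop_atTop.const_mul_atTop hw0)
  -- Ratio test; `2 ^ N` bounds the ratio of consecutive weights `(1 + n) ^ N`.
  have h := (tendsto_prod_mul_Gamma_div_Gamma a b hw).mul_const (2 ^ N * ‖z‖)
  rw [zero_mul] at h
  refine summable_of_ratio_norm_eventually_le (r := 1 / 2) (by norm_num) ?_
  filter_upwards [hx.eventually_gt_atTop 0, h.eventually_lt_const (show (0 : ℝ) < 1 / 2 by norm_num)]
    with n hn hlt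
  have h1 := Real.Gamma_pos_of_pos hn
  have h2 := Real.Gamma_pos_of_pos (show 0 < b + w * (n + 1) by linarith)
  have h3 : 1 + ((n : ℝ) + 1) ≤ 2 * (1 + n) := by linarith [Nat.cast_nonneg (α := ℝ) n]
  rw [Real.norm_of_nonneg (by positivity), Real.norm_of_nonneg (by positivity),
    wrightCoeff_succ (fun i => ha i n) hn hw0, norm_mul, norm_mul, Complex.norm_real,
    Real.norm_of_nonneg (by positivity)]
  calc _ ≤ ‖∏ i, (a i + n)‖ * (Real.Gamma (b + w * n) / Real.Gamma (b + w * (n + 1))) *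
        ‖wrightCoeff a b w n‖ * (2 * (1 + (n : ℝ))) ^ N * ‖z‖ ^ (n + 1) := by
        push_cast
        gcongr
    _ = (‖∏ i, (a i + n)‖ * (Real.Gamma (b + w * n) / Real.Gamma (b + w * (n + 1))) *
          (2 ^ N * ‖z‖)) * (‖wrightCoeff a b w n‖ * (1 + (n : ℝ)) ^ N * ‖z‖ ^ n) := by
        rw [mul_pow]
        ring
    _ ≤ _ := by gcongr

theorem powerDominated_wrightCoeff (ha : ∀ i (n : ℕ), a i + n ≠ 0) (hw : (M : ℝ) < w) (c z : ℂ) :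
    PowerDominated Measure.count (fun n : ℕ => c * wrightCoeff a b w n * z ^ n)
      (fun n => (n : ℂ)) := by
  refine ⟨.of_discrete, .of_discrete, fun N t ht => ?_⟩
  rw [integrable_count_iff]
  refine ((summable_wrightCoeff (b := b) ha hw N (z * t)).mul_left ‖c‖).congr fun n => ?_
  rw [Real.norm_of_nonneg (by positivity)]
  simp [mul_pow, abs_of_pos ht]
  ring

theorem integral_count_eq_tsum (f : ℕ → ℂ) : ∫ n, f n ∂Measure.count = ∑' n, f n := by
  by_cases hf : Integrable f Measure.count
  · rw [integral_countable hf]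
    simp
  · rw [integral_undef hf, tsum_eq_zero_of_not_summable]
    rwa [integrable_count_iff, summable_norm_iff] at hf

end

/-! ### Series solutions. -/

section

variable {M : ℕ} {a : Fin M → ℂ} {b w : ℝ}

theorem tsum_comp_succ {f : ℕ → ℂ} (h0 : f 0 = 0) : ∑' n, f (n + 1) = ∑' n, f n :=
  (add_left_injective 1).tsum_eq fun n hn => by
    cases n with
    | zero => exact absurd h0 hn
    | succ n => exact ⟨n, rfl⟩

/-- The series solutions: the recurrence between the coefficients of the terms
`x^(q₀ + (d - 2) n) t^(α - k + (α + m) n)` is reduced to the identity `hrec`. -/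
theorem isSolution_wrightSeries {α : ℝ} {m : ℕ} {d A B C q₀ : ℝ} {k : ℕ} (hα : 0 ≤ α)
    (hk : k ∈ Finset.Icc 1 (⌊α⌋₊ + 1)) (hM : (M : ℝ) < α + m) (ha : ∀ i (n : ℕ), a i + n ≠ 0)
    (z c : ℂ)
    (hrec : ∀ n : ℕ, z * ∏ i, (a i + n) =
      (A * (q₀ + (d - 2 : ℝ) * n) * (q₀ + (d - 2 : ℝ) * n - 1) + B * (q₀ + (d - 2 : ℝ) * n) + C) *
        ∏ j ∈ Finset.range m, (((α - k : ℝ) : ℂ) + (α + m : ℝ) * n + 1 + j))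
    {u : ℝ → ℝ → ℂ}
    (hu : ∀ x : ℝ, 0 < x → ∀ t : ℝ, 0 < t → u x t =
      ∑' n : ℕ, c * wrightCoeff a (1 + α - k) (α + m) n * z ^ n *
        (x : ℂ) ^ ((q₀ : ℂ) + (d - 2 : ℝ) * n) *
          (t : ℂ) ^ (((α - k : ℝ) : ℂ) + (α + m : ℝ) * n)) :
    IsSolution α m d A B C u := by
  obtain ⟨hk1, hk2⟩ := Finset.mem_Icc.1 hk
  have hw : 0 < α + m := lt_of_le_of_lt (Nat.cast_nonneg M) hM
  have hp₀ : -1 ≤ α - k := by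
    have := Nat.floor_le hα
    have : (k : ℝ) ≤ ⌊α⌋₊ + 1 := by exact_mod_cast hk2
    linarith
  -- If `α` is an integer and `k = ⌊α⌋₊ + 1`, the leading power is the non-integrable `t⁻¹`, but its
  -- coefficient contains `1/Γ(0) = 0`. The next exponent then serves as `ρ`.
  obtain ⟨ρ, hρ, hp⟩ : ∃ ρ > -1, ∀ n : ℕ, c * wrightCoeff a (1 + α - k) (α + m) n * z ^ n ≠ 0 →
      ρ ≤ α - k + (α + m) * (n : ℂ).re := by
    rcases hp₀.eq_or_lt with h | h
    · refine ⟨α - k + (α + m), by linarith, fun n hn => ?_⟩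
      have hn0 : n ≠ 0 := by
        rintro rfl
        refine hn ?_
        simp [wrightCoeff, show 1 + α - k = 0 by linarith]
      have : (1 : ℝ) ≤ n := by exact_mod_cast Nat.one_le_iff_ne_zero.2 hn0
      rw [Complex.natCast_re]
      nlinarith
    · refine ⟨α - k, h, fun n _ => ?_⟩
      rw [Complex.natCast_re]
      exact le_add_of_nonneg_right (by positivity)
  refine isSolution_of_superposition (powerDominated_wrightCoeff ha hM c z) hρ hp
    (fun x hx t ht => (hu x hx t ht).trans (integral_count_eq_tsum _).symm) fun x hx t ht => ?_
  rw [integral_count_eq_tsum, integral_count_eq_tsum, ← tsum_mul_left, ← tsum_comp_succ]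
  · refine tsum_congr fun n => ?_
    have hxc : (x : ℂ) ≠ 0 := by exact_mod_cast hx.ne'
    have htc : (t : ℂ) ≠ 0 := by exact_mod_cast ht.ne'
    have e1 : (x : ℂ) ^ ((q₀ : ℂ) + (d - 2 : ℝ) * (n + 1 : ℕ)) =
        (x ^ (d - 2) : ℝ) * (x : ℂ) ^ ((q₀ : ℂ) + (d - 2 : ℝ) * n) := by
      rw [Complex.ofReal_cpow hx.le, ← Complex.cpow_add _ _ hxc]
      congr 1
      push_cast
      ring
    have e2 : (t : ℂ) ^ (((α - k : ℝ) : ℂ) + (α + m : ℝ) * (n + 1 : ℕ) - α) =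
        (t ^ m : ℝ) * (t : ℂ) ^ (((α - k : ℝ) : ℂ) + (α + m : ℝ) * n) := by
      rw [Complex.ofReal_pow, ← Complex.cpow_natCast, ← Complex.cpow_add _ _ htc]
      congr 1
      push_cast
      ring
    have hb : 0 < α - k + (α + m) * ((n + 1 : ℕ) : ℝ) + 1 := by
      have : 0 ≤ (α + m) * n := by positivity
      push_cast
      linarith
    have hΓ : Complex.Gamma (((α - k : ℝ) : ℂ) + (α + m : ℝ) * (n + 1 : ℕ) + 1) ≠ 0 :=
      Complex.Gamma_ne_zero_of_re_pos (by simpa using hb)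
    have e3 : ∀ i, Complex.Gamma (a i + (n + 1 : ℕ)) = (a i + n) * Complex.Gamma (a i + n) :=
      fun i => by rw [← Complex.Gamma_add_one _ (ha i n)]; push_cast; ring_nf
    have e4 := inv_Gamma_eq_prod_mul m (((α - k : ℝ) : ℂ) + (α + m : ℝ) * n + 1)
    rw [e1, e2]
    simp only [wrightCoeff, e3, Finset.prod_mul_distrib]
    rw [show ((1 + α - k : ℝ) : ℂ) + (α + m : ℝ) * (n + 1 : ℕ) =
        ((α - k : ℝ) : ℂ) + (α + m : ℝ) * (n + 1 : ℕ) + 1 by push_cast; ring,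
      show ((1 + α - k : ℝ) : ℂ) + (α + m : ℝ) * n =
        ((α - k : ℝ) : ℂ) + (α + m : ℝ) * n + 1 by push_cast; ring, div_eq_mul_inv _
        (Complex.Gamma (((α - k : ℝ) : ℂ) + (α + m : ℝ) * n + 1)), e4,
      show ((α - k : ℝ) : ℂ) + (α + m : ℝ) * n + 1 + m =
        ((α - k : ℝ) : ℂ) + (α + m : ℝ) * (n + 1 : ℕ) + 1 - α by push_cast; ring]
    generalize Complex.Gamma (((α - k : ℝ) : ℂ) + (α + m : ℝ) * (n + 1 : ℕ) + 1) = g at *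
    generalize (Complex.Gamma (((α - k : ℝ) : ℂ) + (α + m : ℝ) * (n + 1 : ℕ) + 1 - α))⁻¹ = g'
    generalize (∏ i, Complex.Gamma (a i + n)) = P
    have h := hrec n
    generalize (∏ i, (a i + n)) = P' at *
    generalize (∏ j ∈ Finset.range m, (((α - k : ℝ) : ℂ) + (α + m : ℝ) * n + 1 + j)) = P'' at *
    generalize (x : ℂ) ^ ((q₀ : ℂ) + (d - 2 : ℝ) * n) = X
    generalize (t : ℂ) ^ (((α - k : ℝ) : ℂ) + (α + m : ℝ) * n) = T
    rw [pow_succ, Complex.ofReal_mul, show c * (P' * P / g) * (z ^ n * z) *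
      (((x ^ (d - 2) : ℝ) : ℂ) * X) * (g * g') * (((t ^ m : ℝ) : ℂ) * T) =
      (g / g) * (z * P') * (c * P * z ^ n * ((x ^ (d - 2) : ℝ) : ℂ) * X * g' *
        ((t ^ m : ℝ) : ℂ) * T) by ring, h, div_self hΓ]
    ring
  -- The term `n = 0` drops out of the left side: its Gamma argument is the pole `1 - k`, where the
  -- default value 0 makes the inverse 0 too.
  · have : Complex.Gamma (((α - k : ℝ) : ℂ) + (α + m : ℝ) * (0 : ℕ) + 1 - α) = 0 := by
      rw [← Complex.Gamma_neg_nat_eq_zero (k - 1), Nat.cast_sub hk1]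
      congr 1
      push_cast
      ring
    rw [this]
    simp

theorem wrightTerm_wrightUpper (α : ℝ) (m k : ℕ) (b w : ℝ) (z : ℂ) (n : ℕ) :
    wrightTerm (wrightUpper α m k) (fun _ => 1) ![(b : ℂ)] ![w] z n =
      wrightCoeff (fun i : Fin m => (((α - k + ((i : ℕ) + 1 : ℝ)) / (α + m) : ℝ) : ℂ)) b w n *
        z ^ n := by
  have hf : (n.factorial : ℂ) ≠ 0 := by exact_mod_cast n.factorial_ne_zero
  have h1 : Complex.Gamma (1 + n) = n.factorial := by
    rw [add_comm, Complex.Gamma_nat_eq_factorial]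
  simp only [wrightTerm, wrightCoeff, wrightUpper]
  rw [Fin.prod_univ_add]
  simp only [Fin.append_left, Fin.append_right, Fin.prod_univ_one, Matrix.cons_val_fin_one,
    Complex.ofReal_one, one_mul, h1]
  field_simp

theorem wrightTerm_wrightUpper₂ (α : ℝ) (m k : ℕ) (s₁ s₂ : ℂ) (b w : ℝ) (z : ℂ) (n : ℕ) :
    wrightTerm (wrightUpper₂ α m k s₁ s₂) (fun _ => 1) ![(b : ℂ)] ![w] z n =
      wrightCoeff (Matrix.vecCons ((((α - k : ℝ) : ℂ) - s₁) / ((α + m : ℝ) : ℂ))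
        (Matrix.vecCons ((((α - k : ℝ) : ℂ) - s₂) / ((α + m : ℝ) : ℂ))
          (fun i : Fin m => (((α - k + ((i : ℕ) + 1 : ℝ)) / (α + m) : ℝ) : ℂ)))) b w n * z ^ n := by
  have h := wrightTerm_wrightUpper α m k b w z n
  simp only [wrightTerm, wrightCoeff, wrightUpper₂] at h ⊢
  rw [Fin.prod_univ_succ, Fin.prod_univ_succ]
  conv_rhs => rw [Fin.prod_univ_succ, Fin.prod_univ_succ]
  simp only [Matrix.cons_val_zero, Matrix.cons_val_succ]
  rw [mul_div_assoc, mul_div_assoc, mul_assoc, mul_assoc, h]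
  simp
  ring

variable {α : ℝ} {m k : ℕ}

/-- One factor `α + m` clears each denominator; this is the origin of `(α + m) ^ m` in the argument
of the Wright function. -/
theorem prod_upper_add (hw : 0 < α + m) (k n : ℕ) :
    (((α + m) ^ m : ℝ) : ℂ) *
        ∏ i : Fin m, ((((α - k + ((i : ℕ) + 1 : ℝ)) / (α + m) : ℝ) : ℂ) + n) =
      ∏ j ∈ Finset.range m, (((α - k : ℝ) : ℂ) + (α + m : ℝ) * n + 1 + j) := by
  have hw' : ((α + m : ℝ) : ℂ) ≠ 0 := by exact_mod_cast hw.ne'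
  rw [Finset.prod_range, Complex.ofReal_pow]
  conv_lhs => rw [← Fintype.card_fin m, ← Finset.card_univ, ← Finset.prod_const,
    Finset.card_univ, Fintype.card_fin, ← Finset.prod_mul_distrib]
  refine Finset.prod_congr rfl fun i _ => ?_
  rw [Complex.ofReal_div]
  field_simp
  push_cast
  ring

variable {d A B C : ℝ}

theorem wright_upper_ne (h : WrightDefined (wrightUpper α m k) (fun _ => 1)) (i : Fin m) (n : ℕ) :
    (((α - k + ((i : ℕ) + 1 : ℝ)) / (α + m) : ℝ) : ℂ) + n ≠ 0 := by
  have := h (Fin.castAdd 1 i) n 0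
  simpa only [wrightUpper, Fin.append_left, Complex.ofReal_one, one_mul, Nat.cast_zero, neg_zero]
    using this

theorem summable_wrightTerm_wrightUpper (hα : 0 < α)
    (h : WrightDefined (wrightUpper α m k) (fun _ => 1)) (b : ℝ) (z : ℂ) :
    Summable (wrightTerm (wrightUpper α m k) (fun _ => 1) ![(b : ℂ)] ![α + m] z) := by
  refine Summable.of_norm ?_
  refine (summable_wrightCoeff (b := b) (w := α + m) (wright_upper_ne h) (by linarith) 0 z).congr
    fun n => ?_
  rw [wrightTerm_wrightUpper]
  simp

theorem isSolution_wrightUpper (hα : 0 < α) (hk : k ∈ Finset.Icc 1 (⌊α⌋₊ + 1))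
    (h : WrightDefined (wrightUpper α m k) (fun _ => 1)) (a : ℝ) (c : ℂ) :
    IsSolution α m 2 A B C (fun x t => c * ((x ^ a : ℝ) : ℂ) * ((t ^ (α - k) : ℝ) : ℂ) *
      wright (wrightUpper α m k) (fun _ => 1) ![((1 + α - k : ℝ) : ℂ)] ![α + m]
        (((A * a ^ 2 - A * a + B * a + C) * (α + m) ^ m * t ^ (α + m) : ℝ) : ℂ)) := by
  have hw : 0 < α + m := by positivity
  refine isSolution_wrightSeries (q₀ := a) hα.le hk (by linarith) (wright_upper_ne h)
    (((A * a ^ 2 - A * a + B * a + C) * (α + m) ^ m : ℝ) : ℂ) c (fun n => ?_) fun x hx t ht => ?_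
  · rw [← prod_upper_add hw, Complex.ofReal_mul, mul_assoc]
    congr 1
    push_cast
    ring
  · have htc : (t : ℂ) ≠ 0 := by exact_mod_cast ht.ne'
    simp only [wright, wrightTerm_wrightUpper]
    rw [← tsum_mul_left]
    refine tsum_congr fun n => ?_
    rw [Complex.cpow_add _ _ htc, ← Complex.ofReal_cpow ht.le, Complex.cpow_mul_nat,
      ← Complex.ofReal_cpow ht.le, Complex.ofReal_mul _ (t ^ (α + m)), mul_pow,
      show (a : ℂ) + ((2 - 2 : ℝ) : ℂ) * n = (a : ℝ) by simp, ← Complex.ofReal_cpow hx.le]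
    ring

theorem wright_upper₂_ne {s₁ s₂ : ℂ} (h : WrightDefined (wrightUpper₂ α m k s₁ s₂) (fun _ => 1))
    (i : Fin (m + 2)) (n : ℕ) :
    (Matrix.vecCons ((((α - k : ℝ) : ℂ) - s₁) / ((α + m : ℝ) : ℂ))
        (Matrix.vecCons ((((α - k : ℝ) : ℂ) - s₂) / ((α + m : ℝ) : ℂ))
          (fun i : Fin m => (((α - k + ((i : ℕ) + 1 : ℝ)) / (α + m) : ℝ) : ℂ)))) i + n ≠ 0 := by
  refine Fin.cases ?_ (fun i => Fin.cases ?_ (fun i => ?_) i) i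
  · simpa [wrightUpper₂] using h 0 n 0
  · simpa [wrightUpper₂] using h 1 n 0
  · have := h (Fin.succ (Fin.succ (Fin.castAdd 1 i))) n 0
    simpa only [wrightUpper₂, wrightUpper, Matrix.cons_val_succ, Fin.append_left,
      Complex.ofReal_one, one_mul, Nat.cast_zero, neg_zero] using this

theorem summable_wrightTerm_wrightUpper₂ (hα : 2 < α) {s₁ s₂ : ℂ}
    (h : WrightDefined (wrightUpper₂ α m k s₁ s₂) (fun _ => 1)) (b : ℝ) (z : ℂ) :
    Summable (wrightTerm (wrightUpper₂ α m k s₁ s₂) (fun _ => 1) ![(b : ℂ)] ![α + m] z) := by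
  refine Summable.of_norm ?_
  refine (summable_wrightCoeff (b := b) (w := α + m) (wright_upper₂_ne h)
    (by push_cast; linarith) 0 z).congr fun n => ?_
  rw [wrightTerm_wrightUpper₂]
  simp

/-- The roots `s₁`, `s₂` correspond to the roots of the indicial polynomial. -/
theorem indicial_eq_mul (hw : 0 < α + m) (hA : A ≠ 0) (hd : d ≠ 2) {a : ℝ} {r : ℂ}
    (hr : r ^ 2 = (((1 - B / A) ^ 2 - 4 * C / A : ℝ) : ℂ)) (σ : ℂ) :
    A * (a + (d - 2 : ℝ) * σ) * (a + (d - 2 : ℝ) * σ - 1) + B * (a + (d - 2 : ℝ) * σ) + C =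
      ((A * (d - 2) ^ 2 : ℝ) : ℂ) * ((σ - sRoot α m d A B a r / ((α + m : ℝ) : ℂ)) *
        (σ - sRoot α m d A B a (-r) / ((α + m : ℝ) : ℂ))) := by
  have hw' : ((α + m : ℝ) : ℂ) ≠ 0 := by exact_mod_cast hw.ne'
  have hA' : (A : ℂ) ≠ 0 := by exact_mod_cast hA
  have hd' : (2 : ℂ) - d ≠ 0 := by
    rw [sub_ne_zero]
    exact_mod_cast hd.symm
  have e (r : ℂ) : sRoot α m d A B a r / ((α + m : ℝ) : ℂ) =
      ((B / A + 2 * a - 1 : ℝ) + r) / (2 * (2 - d)) := by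
    rw [sRoot, Complex.ofReal_div]
    push_cast at hw' ⊢
    field_simp
  rw [e, e]
  push_cast at hr ⊢
  -- Completing the square leaves only `r ^ 2`, so the choice of the square root is immaterial.
  have e2 : (A * (d - 2 : ℂ) ^ 2) * ((σ - ((B / A + 2 * a - 1) + r) / (2 * (2 - d))) *
      (σ - ((B / A + 2 * a - 1) + -r) / (2 * (2 - d)))) =
      A / 4 * ((2 * (2 - d) * σ - (B / A + 2 * a - 1)) ^ 2 - r ^ 2) := by
    field_simp
    ring
  rw [e2, hr]
  field_simp
  ring

theorem isSolution_wrightUpper₂ (hα : 2 < α) (hk : k ∈ Finset.Icc 1 (⌊α⌋₊ + 1))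
    (hA : A ≠ 0) (hd : d ≠ 2) {a : ℝ} {r : ℂ}
    (hr : r ^ 2 = (((1 - B / A) ^ 2 - 4 * C / A : ℝ) : ℂ)) {s₁ s₂ : ℂ}
    (hs₁ : s₁ = sRoot α m d A B a r) (hs₂ : s₂ = sRoot α m d A B a (-r))
    (h : WrightDefined (wrightUpper₂ α m k s₁ s₂) (fun _ => 1)) (c : ℂ) :
    IsSolution α m d A B C (fun x t => c * ((x ^ a : ℝ) : ℂ) *
      ((x ^ ((d - 2) * (α - k) / (α + m)) : ℝ) : ℂ) * ((t ^ (α - k) : ℝ) : ℂ) *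
      wright (wrightUpper₂ α m k s₁ s₂) (fun _ => 1) ![((1 + α - k : ℝ) : ℂ)] ![α + m]
        ((A * (d - 2) ^ 2 * (α + m) ^ m * x ^ (d - 2) * t ^ (α + m) : ℝ) : ℂ)) := by
  have hw : 0 < α + m := by positivity
  have hw' : ((α + m : ℝ) : ℂ) ≠ 0 := by exact_mod_cast hw.ne'
  refine isSolution_wrightSeries (q₀ := a + (d - 2) * (α - k) / (α + m)) (by linarith) hk
    (by push_cast; linarith) (wright_upper₂_ne h)
    ((A * (d - 2) ^ 2 * (α + m) ^ m : ℝ) : ℂ) c (fun n => ?_) fun x hx t ht => ?_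
  · rw [← prod_upper_add hw]
    -- The extra power of `x` moves the indicial variable to `(α - k)/(α + m) + n`, so that its
    -- distances to the roots are the first two upper parameters plus `n`.
    have hσ : ((a + (d - 2) * (α - k) / (α + m) : ℝ) : ℂ) + (d - 2 : ℝ) * n =
        a + (d - 2 : ℝ) * (((α - k : ℝ) : ℂ) / (α + m : ℝ) + n) := by
      push_cast
      ring
    rw [hσ, indicial_eq_mul hw hA hd hr, ← hs₁, ← hs₂, Fin.prod_univ_succ, Fin.prod_univ_succ]
    simp only [Matrix.cons_val_zero, Matrix.cons_val_succ]
    rw [Complex.ofReal_mul (A * (d - 2) ^ 2), sub_div, sub_div]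
    ring
  · have htc : (t : ℂ) ≠ 0 := by exact_mod_cast ht.ne'
    have hxc : (x : ℂ) ≠ 0 := by exact_mod_cast hx.ne'
    simp only [wright, wrightTerm_wrightUpper₂]
    rw [← tsum_mul_left]
    refine tsum_congr fun n => ?_
    rw [Complex.cpow_add _ _ htc, ← Complex.ofReal_cpow ht.le, Complex.cpow_mul_nat,
      ← Complex.ofReal_cpow ht.le, Complex.ofReal_mul _ (t ^ (α + m)), mul_pow,
      Complex.ofReal_mul _ (x ^ (d - 2)), mul_pow, Complex.cpow_add _ _ hxc,
      ← Complex.ofReal_cpow hx.le, Complex.cpow_mul_nat, ← Complex.ofReal_cpow hx.le,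
      Real.rpow_add hx, Complex.ofReal_mul (x ^ a)]
    ring

end

/-! ### Bounds for Gamma and its reciprocal on vertical strips. -/

section

theorem norm_Gamma_div_le {p : ℂ} {β : ℝ} (hp : 0 < p.re) (hβ : 0 < β) :
    ‖Complex.Gamma p / Complex.Gamma (p + β)‖ ≤ Real.Gamma p.re / Real.Gamma (p.re + β) := by
  have hρ : -1 < p.re - 1 := by linarith
  have h := norm_Gamma_div_Gamma_le hβ hρ (p := p - 1) (by simp)
  rw [sub_add_cancel] at h
  refine h.trans (le_of_eq ?_)
  have e := ofReal_rpow_mul_cpow_integral one_pos hβ (p := (p.re - 1 : ℝ)) (by simpa using hρ)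
  have e2 : ∫ τ in (0 : ℝ)..1, (((1 - τ) ^ (β - 1) : ℝ) : ℂ) * (τ : ℂ) ^ ((p.re - 1 : ℝ) : ℂ) =
      ((∫ τ in (0 : ℝ)..1, (1 - τ) ^ (β - 1) * τ ^ (p.re - 1) : ℝ) : ℂ) := by
    rw [← intervalIntegral.integral_ofReal]
    refine intervalIntegral.integral_congr fun τ hτ => ?_
    rw [uIcc_of_le zero_le_one] at hτ
    rw [← Complex.ofReal_cpow hτ.1, ← Complex.ofReal_mul]
  rw [e2, Complex.ofReal_one, Complex.one_cpow, mul_one,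
    show ((p.re - 1 : ℝ) : ℂ) + 1 = (p.re : ℝ) by push_cast; ring, ← Complex.ofReal_add,
    Complex.Gamma_ofReal, Complex.Gamma_ofReal, Complex.Gamma_ofReal] at e
  have hβ' := (Real.Gamma_pos_of_pos hβ).ne'
  rw [inv_mul_eq_iff_eq_mul₀ hβ']
  exact_mod_cast e

/-- The reflection formula, because `1 - s` is the conjugate of `s` on the line `Re s = 1/2`. -/
theorem normSq_Gamma_half (y : ℝ) :
    ‖Complex.Gamma (1 / 2 + y * Complex.I)‖ ^ 2 = Real.pi / Real.cosh (Real.pi * y) := by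
  have h := Complex.Gamma_mul_Gamma_one_sub (1 / 2 + y * Complex.I)
  have e : (1 : ℂ) - (1 / 2 + y * Complex.I) =
      (starRingEnd ℂ) (1 / 2 + y * Complex.I) := by
    simp only [map_add, map_mul, map_div₀, map_one, Complex.conj_ofReal, Complex.conj_I,
      map_ofNat]
    ring
  rw [e, Complex.Gamma_conj, Complex.mul_conj, Complex.normSq_eq_norm_sq,
    show (Real.pi : ℂ) * (1 / 2 + y * Complex.I) = (Real.pi * y : ℝ) * Complex.I + Real.pi / 2 by
      push_cast; ring, Complex.sin_add_pi_div_two, Complex.cos_mul_I, ← Complex.ofReal_cosh] at h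
  exact_mod_cast h

theorem norm_Gamma_half_le (y : ℝ) :
    ‖Complex.Gamma (1 / 2 + y * Complex.I)‖ ≤ 3 * Real.exp (-(Real.pi / 2) * |y|) := by
  refine le_of_sq_le_sq ?_ (by positivity)
  rw [normSq_Gamma_half, ← Real.cosh_abs, abs_mul, abs_of_pos Real.pi_pos, Real.cosh_eq, mul_pow,
    ← Real.exp_nat_mul, div_le_iff₀ (by positivity)]
  have h1 : Real.exp ((2 : ℕ) * (-(Real.pi / 2) * |y|)) * Real.exp (Real.pi * |y|) = 1 := by
    rw [← Real.exp_add, Real.exp_eq_one_iff]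
    push_cast
    ring
  have h2 : 0 < Real.exp ((2 : ℕ) * (-(Real.pi / 2) * |y|)) * Real.exp (-(Real.pi * |y|)) := by
    positivity
  -- From `cosh x ≥ exp |x| / 2`, the constant only has to satisfy `2π ≤ 3²`.
  nlinarith [Real.pi_lt_d2]

theorem inv_norm_Gamma_half_le (y : ℝ) :
    ‖Complex.Gamma (1 / 2 + y * Complex.I)‖⁻¹ ≤ Real.exp (Real.pi / 2 * |y|) := by
  refine le_of_sq_le_sq ?_ (by positivity)
  rw [inv_pow, normSq_Gamma_half, ← Real.cosh_abs, abs_mul, abs_of_pos Real.pi_pos, inv_div,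
    Real.cosh_eq, ← Real.exp_nat_mul, div_le_iff₀ Real.pi_pos,
    show (2 : ℕ) * (Real.pi / 2 * |y|) = Real.pi * |y| by push_cast; ring]
  have h1 : Real.exp (-(Real.pi * |y|)) ≤ Real.exp (Real.pi * |y|) :=
    Real.exp_le_exp.2 (by have : 0 ≤ Real.pi * |y| := by positivity
                          linarith)
  nlinarith [Real.pi_gt_three, Real.exp_pos (Real.pi * |y|)]

/-- On the strip `σ₀ ≤ Re s ≤ σ₁` the function `F` is `O(|Im s|^N exp(κ |Im s|))`. -/
def StripBound (κ : ℝ) (F : ℂ → ℂ) (σ₀ σ₁ : ℝ) : Prop :=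
  ∃ (C : ℝ) (N : ℕ), 0 ≤ C ∧ ∀ s : ℂ, σ₀ ≤ s.re → s.re ≤ σ₁ →
    ‖F s‖ ≤ C * (1 + |s.im|) ^ N * Real.exp (κ * |s.im|)

namespace StripBound

variable {κ κ' : ℝ} {F H : ℂ → ℂ} {σ₀ σ₁ : ℝ}

theorem mul (hF : StripBound κ F σ₀ σ₁) (hH : StripBound κ' H σ₀ σ₁) :
    StripBound (κ + κ') (fun s => F s * H s) σ₀ σ₁ := by
  obtain ⟨C, N, hC, h⟩ := hF
  obtain ⟨C', N', hC', h'⟩ := hH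
  refine ⟨C * C', N + N', by positivity, fun s h0 h1 => ?_⟩
  rw [norm_mul]
  calc ‖F s‖ * ‖H s‖ ≤ (C * (1 + |s.im|) ^ N * Real.exp (κ * |s.im|)) *
        (C' * (1 + |s.im|) ^ N' * Real.exp (κ' * |s.im|)) := by
        gcongr
        · exact h s h0 h1
        · exact h' s h0 h1
    _ = _ := by rw [add_mul, Real.exp_add, pow_add]; ring

theorem of_norm_le (C : ℝ) (hF : ∀ s : ℂ, σ₀ ≤ s.re → s.re ≤ σ₁ → ‖F s‖ ≤ C) :
    StripBound 0 F σ₀ σ₁ :=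
  ⟨|C|, 0, abs_nonneg C, fun s h0 h1 => by simpa using (hF s h0 h1).trans (le_abs_self C)⟩

theorem prod {n : ℕ} {F : Fin n → ℂ → ℂ} (h : ∀ i, StripBound κ (F i) σ₀ σ₁) :
    StripBound (n * κ) (fun s => ∏ i, F i s) σ₀ σ₁ := by
  induction n with
  | zero => simpa using of_norm_le (F := fun _ => 1) 1 (by simp)
  | succ n ih =>
    simp only [Fin.prod_univ_succ]
    have := (h 0).mul (ih fun i => h i.succ)
    rwa [show κ + n * κ = ((n + 1 : ℕ) : ℝ) * κ by push_cast; ring] at this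

theorem comp_sub_mul {w : ℝ} (hw : 0 ≤ w) (b : ℂ)
    (hF : StripBound κ F (b.re - w * σ₁) (b.re - w * σ₀)) :
    StripBound (κ * w) (fun s => F (b - w * s)) σ₀ σ₁ := by
  obtain ⟨C, N, hC, h⟩ := hF
  refine ⟨C * (1 + |b.im| + w) ^ N * Real.exp (|κ| * |b.im|), N, by positivity,
    fun s h0 h1 => ?_⟩
  have hre : (b - w * s).re = b.re - w * s.re := by simp
  have him : (b - w * s).im = b.im - w * s.im := by simp
  have hb := h (b - w * s) (by rw [hre]; gcongr) (by rw [hre]; gcongr)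
  rw [him] at hb
  have hws : |w * s.im| = w * |s.im| := by rw [abs_mul, abs_of_nonneg hw]
  have e1 : 1 + |b.im - w * s.im| ≤ (1 + |b.im| + w) * (1 + |s.im|) := by
    have := abs_sub b.im (w * s.im)
    nlinarith [abs_nonneg b.im, abs_nonneg s.im, mul_nonneg (abs_nonneg b.im) (abs_nonneg s.im)]
  -- For either sign of `κ`, the shift by `b.im` costs only a constant factor.
  have e2 : κ * |b.im - w * s.im| ≤ |κ| * |b.im| + κ * w * |s.im| := by
    have h3 : |(|b.im - w * s.im| - |w * s.im|)| ≤ |b.im| := by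
      have := abs_abs_sub_abs_le_abs_sub (b.im - w * s.im) (-(w * s.im))
      rw [abs_neg] at this
      simpa using this
    have h4 : κ * (|b.im - w * s.im| - |w * s.im|) ≤ |κ| * |b.im| :=
      (le_abs_self _).trans (by rw [abs_mul]; gcongr)
    rw [hws] at h4
    linarith
  refine hb.trans ?_
  calc C * (1 + |b.im - w * s.im|) ^ N * Real.exp (κ * |b.im - w * s.im|)
      ≤ C * ((1 + |b.im| + w) * (1 + |s.im|)) ^ N *
        Real.exp (|κ| * |b.im| + κ * w * |s.im|) := by gcongr
    _ = _ := by rw [mul_pow, Real.exp_add]; ring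

/-- Exponential decay dominates every polynomial. -/
theorem exists_le_inv (hF : StripBound κ F σ₀ σ₁) (hκ : κ < 0) (M : ℕ) :
    ∃ C, 0 ≤ C ∧ ∀ s : ℂ, σ₀ ≤ s.re → s.re ≤ σ₁ →
      ‖F s‖ * (1 + |s.im|) ^ M ≤ C * (1 + s.im ^ 2)⁻¹ := by
  obtain ⟨C, N, hC, h⟩ := hF
  -- The bound `X ^ n / n! ≤ exp X` is used at `X = -κ (1 + |Im s|)`; the extra 2 pays for `1 + (Im
  -- s)²`.
  set n := N + M + 2
  have hκ' : 0 < -κ := by linarith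
  refine ⟨C * (n.factorial * Real.exp (-κ) / (-κ) ^ n), by positivity, fun s h0 h1 => ?_⟩
  have hx : 0 ≤ -κ * (1 + |s.im|) := by positivity
  have he := Real.pow_div_factorial_le_exp _ hx n
  have h2 : (1 + |s.im|) ^ n * Real.exp (κ * |s.im|) ≤ n.factorial * Real.exp (-κ) / (-κ) ^ n := by
    rw [le_div_iff₀ (by positivity)]
    rw [div_le_iff₀ (by positivity), mul_pow, mul_add, mul_one, Real.exp_add] at he
    calc (1 + |s.im|) ^ n * Real.exp (κ * |s.im|) * (-κ) ^ n
        = ((-κ) ^ n * (1 + |s.im|) ^ n) * Real.exp (κ * |s.im|) := by ring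
      _ ≤ (Real.exp (-κ) * Real.exp (-κ * |s.im|) * n.factorial) * Real.exp (κ * |s.im|) := by
          gcongr
      _ = n.factorial * Real.exp (-κ) * (Real.exp (-κ * |s.im|) * Real.exp (κ * |s.im|)) := by ring
      _ = _ := by rw [← Real.exp_add]; simp
  have h3 : 1 + s.im ^ 2 ≤ (1 + |s.im|) ^ 2 := by
    nlinarith [abs_nonneg s.im, sq_abs s.im]
  rw [← div_eq_mul_inv, le_div_iff₀ (by positivity)]
  calc ‖F s‖ * (1 + |s.im|) ^ M * (1 + s.im ^ 2)
      ≤ (C * (1 + |s.im|) ^ N * Real.exp (κ * |s.im|)) * (1 + |s.im|) ^ M * (1 + |s.im|) ^ 2 := by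
        gcongr
        exact h s h0 h1
    _ = C * ((1 + |s.im|) ^ n * Real.exp (κ * |s.im|)) := by
        simp only [n, pow_add]
        ring
    _ ≤ _ := by gcongr

end StripBound

theorem continuousOn_realGamma {σ₀ σ₁ : ℝ} (h : 0 < σ₀) :
    ContinuousOn Real.Gamma (Icc σ₀ σ₁) := fun σ hσ =>
  (Real.differentiableAt_Gamma fun n => by
    have := h.trans_le hσ.1
    have : (0 : ℝ) ≤ n := Nat.cast_nonneg n
    linarith).continuousAt.continuousWithinAt

/-- At equal height, `norm_Gamma_div_le` compares `Γ(s)` with Gamma on the line `Re = 1/2 + n` to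
the right of the strip. The functional equation descends to `Re = 1/2` at polynomial cost, and there
the modulus is explicit. -/
theorem stripBound_Gamma {σ₀ σ₁ : ℝ} (h : 0 < σ₀) :
    StripBound (-(Real.pi / 2)) Complex.Gamma σ₀ σ₁ := by
  obtain ⟨n, hn⟩ := exists_nat_gt σ₁
  obtain ⟨C, hC⟩ := isCompact_Icc.exists_bound_of_continuousOn (continuousOn_realGamma (σ₁ := σ₁) h)
  have hK := Real.Gamma_pos_of_pos (show (0 : ℝ) < 1 / 2 + n by positivity)
  refine ⟨|C| / Real.Gamma (1 / 2 + n) * ((1 + n) ^ n * 3), n, by positivity, fun s h0 h1 => ?_⟩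
  have hσ : 0 < s.re := h.trans_le h0
  set w : ℂ := 1 / 2 + s.im * Complex.I
  have hs : s + (1 / 2 + n - s.re : ℝ) = w + n := by
    apply Complex.ext <;> simp [w]
  have hb := norm_Gamma_div_le hσ (show 0 < 1 / 2 + n - s.re by linarith)
  have hne : Complex.Gamma (w + n) ≠ 0 :=
    Complex.Gamma_ne_zero_of_re_pos (by simp [w]; positivity)
  have hne' : Complex.Gamma w ≠ 0 := Complex.Gamma_ne_zero_of_re_pos (by simp [w])
  rw [hs, add_sub_cancel, norm_div, div_le_iff₀ (norm_pos_iff.2 hne)] at hb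
  have e := inv_Gamma_eq_prod_mul n w
  have e' : Complex.Gamma (w + n) = (∏ i ∈ Finset.range n, (w + i)) * Complex.Gamma w := by
    field_simp at e
    exact e.trans (mul_comm _ _)
  have hprod : ‖∏ i ∈ Finset.range n, (w + i)‖ ≤ ((1 + n) * (1 + |s.im|)) ^ n := by
    rw [norm_prod]
    refine (Finset.prod_le_prod (fun i _ => norm_nonneg _) fun i hi => ?_).trans_eq
      (by rw [Finset.prod_const, Finset.card_range])
    have hi : (i : ℝ) + 1 ≤ n := by exact_mod_cast Finset.mem_range.1 hi
    have := Complex.norm_le_abs_re_add_abs_im (w + i)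
    have hre : (w + i).re = 1 / 2 + i := by simp [w]
    have him : (w + i).im = s.im := by simp [w]
    rw [hre, him, abs_of_nonneg (by positivity)] at this
    nlinarith [abs_nonneg s.im, mul_nonneg (Nat.cast_nonneg (α := ℝ) n) (abs_nonneg s.im)]
  have hΓ : Real.Gamma s.re ≤ |C| := (le_abs_self _).trans ((hC s.re ⟨h0, h1⟩).trans (le_abs_self C))
  have hw : ‖Complex.Gamma w‖ ≤ _ := norm_Gamma_half_le s.im
  calc ‖Complex.Gamma s‖ ≤ Real.Gamma s.re / Real.Gamma (1 / 2 + n) * ‖Complex.Gamma (w + n)‖ := hb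
    _ ≤ |C| / Real.Gamma (1 / 2 + n) * (((1 + n) * (1 + |s.im|)) ^ n *
        (3 * Real.exp (-(Real.pi / 2) * |s.im|))) := by
        rw [e', norm_mul]
        gcongr
    _ = _ := by rw [mul_pow]; ring

theorem stripBound_add_const (c : ℝ) (σ₀ σ₁ : ℝ) : StripBound 0 (fun s => s + c) σ₀ σ₁ := by
  refine ⟨1 + |σ₀| + |σ₁| + |c|, 1, by positivity, fun s h0 h1 => ?_⟩
  have := Complex.norm_le_abs_re_add_abs_im (s + c)
  have hre : |(s + c : ℂ).re| ≤ |σ₀| + |σ₁| + |c| := by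
    rw [Complex.add_re, Complex.ofReal_re]
    refine (abs_add_le _ _).trans ?_
    gcongr
    exact abs_le.2 ⟨by linarith [neg_abs_le σ₀, abs_nonneg σ₁], by
      linarith [le_abs_self σ₁, abs_nonneg σ₀]⟩
  have him : (s + c : ℂ).im = s.im := by simp
  rw [him] at this
  rw [zero_mul, Real.exp_zero, mul_one, pow_one]
  nlinarith [abs_nonneg s.im, abs_nonneg σ₀, abs_nonneg σ₁, abs_nonneg c,
    mul_nonneg (abs_nonneg σ₀) (abs_nonneg s.im), mul_nonneg (abs_nonneg σ₁) (abs_nonneg s.im),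
    mul_nonneg (abs_nonneg c) (abs_nonneg s.im)]

/-- The same comparison in the other direction: now the line `Re = 1/2` lies to the left of the
strip. -/
theorem stripBound_inv_Gamma_of_one_le {σ₀ σ₁ : ℝ} (h : 1 ≤ σ₀) :
    StripBound (Real.pi / 2) (fun s => (Complex.Gamma s)⁻¹) σ₀ σ₁ := by
  have h0' : 0 < σ₀ := by linarith
  obtain ⟨C, hC⟩ := isCompact_Icc.exists_bound_of_continuousOn
    ((continuousOn_realGamma (σ₁ := σ₁) h0').inv₀ fun σ hσ =>
      (Real.Gamma_pos_of_pos (h0'.trans_le hσ.1)).ne')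
  have hK := Real.Gamma_pos_of_pos (show (0 : ℝ) < 1 / 2 by positivity)
  refine ⟨Real.Gamma (1 / 2) * |C|, 0, by positivity, fun s h0 h1 => ?_⟩
  set w : ℂ := 1 / 2 + s.im * Complex.I
  have hwre : w.re = 1 / 2 := by simp [w]
  have hs : w + (s.re - 1 / 2 : ℝ) = s := by
    apply Complex.ext <;> simp [w]
  have hb := norm_Gamma_div_le (p := w) (by rw [hwre]; norm_num)
    (show 0 < s.re - 1 / 2 by linarith)
  have hne' : Complex.Gamma w ≠ 0 := Complex.Gamma_ne_zero_of_re_pos (by simp [w])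
  rw [hs, hwre, add_sub_cancel, norm_div, div_eq_mul_inv ‖_‖, mul_comm,
    ← le_div_iff₀ (norm_pos_iff.2 hne'), ← norm_inv, div_eq_mul_inv, div_eq_mul_inv] at hb
  have hΓ : (Real.Gamma s.re)⁻¹ ≤ |C| :=
    (le_abs_self _).trans ((hC s.re ⟨h0, h1⟩).trans (le_abs_self C))
  have hw : ‖Complex.Gamma w‖⁻¹ ≤ _ := inv_norm_Gamma_half_le s.im
  rw [pow_zero, mul_one]
  refine hb.trans ?_
  gcongr

theorem stripBound_inv_Gamma (σ₀ σ₁ : ℝ) :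
    StripBound (Real.pi / 2) (fun s => (Complex.Gamma s)⁻¹) σ₀ σ₁ := by
  obtain ⟨n, hn⟩ := exists_nat_ge (1 - σ₀)
  obtain ⟨C, N, hC, h⟩ := stripBound_inv_Gamma_of_one_le (σ₀ := σ₀ + n) (σ₁ := σ₁ + n)
    (by linarith)
  have h1 : StripBound (Real.pi / 2) (fun s => (Complex.Gamma (s + n))⁻¹) σ₀ σ₁ :=
    ⟨C, N, hC, fun s h0 h1 => by simpa using h (s + n) (by simpa using h0) (by simpa using h1)⟩
  have h2 := (StripBound.prod fun i : Fin n => stripBound_add_const (i : ℕ) σ₀ σ₁).mul h1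
  rw [mul_zero, zero_add] at h2
  convert h2 using 2 with s
  rw [inv_Gamma_eq_prod_mul n s, Finset.prod_range]
  simp

end

/-! ### Mellin-Barnes integrals and the shift of their contour. -/

section

namespace StripBound

variable {κ : ℝ} {F : ℂ → ℂ} {σ₀ σ₁ : ℝ}

theorem continuous_vertical {σ : ℝ} (hd : ∀ s : ℂ, s.re = σ → DifferentiableAt ℂ F s) :
    Continuous fun y : ℝ => F (σ + y * Complex.I) :=
  continuous_iff_continuousAt.2 fun y =>
    ContinuousAt.comp (f := fun y : ℝ => (σ : ℂ) + y * Complex.I)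
      (hd _ (by simp)).continuousAt (by fun_prop)

theorem integrable_vertical {σ : ℝ} (hF : StripBound κ F σ σ) (hκ : κ < 0)
    (hd : ∀ s : ℂ, s.re = σ → DifferentiableAt ℂ F s) (N : ℕ) :
    Integrable fun y : ℝ => ‖F (σ + y * Complex.I)‖ * (1 + |y|) ^ N := by
  obtain ⟨C, hC, h⟩ := hF.exists_le_inv hκ N
  refine (integrable_inv_one_add_sq.const_mul C).mono' ?_ (Eventually.of_forall fun y => ?_)
  · exact ((continuous_vertical hd).norm.mul (by fun_prop)).aestronglyMeasurable
  · rw [Real.norm_of_nonneg (by positivity)]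
    simpa using h (σ + y * Complex.I) (by simp) (by simp)

theorem mono (hF : StripBound κ F σ₀ σ₁) {τ₀ τ₁ : ℝ} (h0 : σ₀ ≤ τ₀) (h1 : τ₁ ≤ σ₁) :
    StripBound κ F τ₀ τ₁ := by
  obtain ⟨C, N, hC, h⟩ := hF
  exact ⟨C, N, hC, fun s hs0 hs1 => h s (h0.trans hs0) (hs1.trans h1)⟩

/-- Shift of the line of integration of a Mellin-Barnes integral. -/
theorem integral_vertical_eq (hF : StripBound κ F σ₀ σ₁) (hκ : κ < 0) (hσ : σ₀ ≤ σ₁)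
    (hd : ∀ s : ℂ, σ₀ ≤ s.re → s.re ≤ σ₁ → DifferentiableAt ℂ F s) :
    ∫ y : ℝ, F (σ₀ + y * Complex.I) = ∫ y : ℝ, F (σ₁ + y * Complex.I) := by
  obtain ⟨C, hC, h⟩ := hF.exists_le_inv hκ 0
  have hint : ∀ σ : ℝ, σ₀ ≤ σ → σ ≤ σ₁ → Tendsto
      (fun T : ℝ => ∫ y in (-T)..T, F (σ + y * Complex.I)) atTop
        (𝓝 (∫ y : ℝ, F (σ + y * Complex.I))) := by
    intro σ h0 h1
    have hd' : ∀ s : ℂ, s.re = σ → DifferentiableAt ℂ F s := fun s hs =>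
      hd s (hs ▸ h0) (hs ▸ h1)
    have := (hF.mono h0 h1).integrable_vertical hκ hd' 0
    simp only [pow_zero, mul_one] at this
    exact intervalIntegral_tendsto_integral
      ((integrable_norm_iff (continuous_vertical hd').aestronglyMeasurable).1 this)
      tendsto_neg_atTop_atBot tendsto_id
  have hdecay : Tendsto (fun T : ℝ => C * (1 + T ^ 2)⁻¹ * |σ₁ - σ₀|) atTop (𝓝 0) := by
    have h1 : Tendsto (fun T : ℝ => 1 + T ^ 2) atTop atTop :=
      tendsto_atTop_add_const_left _ _ (tendsto_pow_atTop two_ne_zero)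
    simpa using ((h1.inv_tendsto_atTop).const_mul C).mul_const |σ₁ - σ₀|
  -- The horizontal sides of the rectangle, bottom for `ε = -1` and top for `ε = 1`, contribute
  -- nothing in the limit.
  have hhor : ∀ ε : ℝ, ε ^ 2 = 1 → Tendsto
      (fun T : ℝ => ∫ x in σ₀..σ₁, F (x + (ε * T : ℝ) * Complex.I)) atTop (𝓝 0) := by
    intro ε hε
    refine squeeze_zero_norm (fun T => ?_) hdecay
    refine intervalIntegral.norm_integral_le_of_norm_le_const fun x hx => ?_
    rw [uIoc_of_le hσ] at hx
    have := h (x + (ε * T : ℝ) * Complex.I) (by simpa using hx.1.le) (by simpa using hx.2)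
    simpa [mul_pow, hε] using this
  have hrect : ∀ T : ℝ, (∫ x in σ₀..σ₁, F (x + (-1 * T : ℝ) * Complex.I)) -
      (∫ x in σ₀..σ₁, F (x + (1 * T : ℝ) * Complex.I)) +
      Complex.I * (∫ y in (-T)..T, F (σ₁ + y * Complex.I)) -
      Complex.I * (∫ y in (-T)..T, F (σ₀ + y * Complex.I)) = 0 := by
    intro T
    have := Complex.integral_boundary_rect_eq_zero_of_differentiableOn F
      (⟨σ₀, -T⟩ : ℂ) (⟨σ₁, T⟩ : ℂ) fun s hs => by
        have hs' := hs.1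
        simp only [mem_preimage, uIcc_of_le hσ] at hs'
        exact (hd s hs'.1 hs'.2).differentiableWithinAt
    simpa using this
  have hlim := (((hhor (-1) (by norm_num)).sub (hhor 1 (by norm_num))).add
    ((hint σ₁ hσ le_rfl).const_mul Complex.I)).sub ((hint σ₀ le_rfl hσ).const_mul Complex.I)
  have := tendsto_nhds_unique (hlim.congr hrect) tendsto_const_nhds
  rw [sub_zero, zero_add, ← mul_sub, mul_eq_zero] at this
  exact (sub_eq_zero.1 (this.resolve_left Complex.I_ne_zero)).symm

end StripBound

/-- The integrand `∏ Γ(b_j - s) / Γ(κ - w s) z^s` of a Mellin-Barnes integral. -/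
def mellinKernel {n : ℕ} (b : Fin n → ℂ) (κ w : ℝ) (z : ℝ) (s : ℂ) : ℂ :=
  (∏ j, Complex.Gamma (b j - s)) * (Complex.Gamma (κ - w * s))⁻¹ * (z : ℂ) ^ s

section mellinKernel

variable {n : ℕ} {b : Fin n → ℂ} {κ w z σ₀ σ₁ : ℝ}

/-- Each numerator Gamma contributes the rate `-π/2`, the reciprocal Gamma `(π/2) w`, and `z^s` is
bounded on the strip. -/
theorem stripBound_mellinKernel (hb : ∀ j, σ₁ < (b j).re) (hw : 0 ≤ w) (hz : 0 < z) :
    StripBound (-(Real.pi / 2) * (n - w)) (mellinKernel b κ w z) σ₀ σ₁ := by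
  have h1 : StripBound (n * (-(Real.pi / 2) * 1)) (fun s => ∏ j, Complex.Gamma (b j - (1 : ℝ) * s))
      σ₀ σ₁ := StripBound.prod fun j =>
    (stripBound_Gamma (by have := hb j; linarith)).comp_sub_mul zero_le_one (b j)
  have h2 := (stripBound_inv_Gamma ((κ : ℂ).re - w * σ₁) ((κ : ℂ).re - w * σ₀)).comp_sub_mul hw κ
  have h3 : StripBound 0 (fun s => (z : ℂ) ^ s) σ₀ σ₁ := by
    refine StripBound.of_norm_le (z ^ σ₀ + z ^ σ₁) fun s h0 h1 => ?_
    rw [Complex.norm_cpow_eq_rpow_re_of_pos hz]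
    rcases le_total 1 z with hz1 | hz1
    · exact (Real.rpow_le_rpow_of_exponent_le hz1 h1).trans
        (le_add_of_nonneg_left (by positivity))
    · exact (Real.rpow_le_rpow_of_exponent_ge hz hz1 h0).trans
        (le_add_of_nonneg_right (by positivity))
  have h := (h1.mul h2).mul h3
  simp only [Complex.ofReal_one, one_mul] at h
  rwa [show (n : ℝ) * (-(Real.pi / 2) * 1) + Real.pi / 2 * w + 0 = -(Real.pi / 2) * (n - w) by
    ring] at h

theorem differentiableAt_mellinKernel (hz : 0 < z) {s : ℂ} (hs : ∀ j, s.re < (b j).re) :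
    DifferentiableAt ℂ (mellinKernel b κ w z) s := by
  refine (DifferentiableAt.mul (DifferentiableAt.fun_finsetProd fun j _ => ?_) ?_).mul ?_
  · refine DifferentiableAt.comp s (Complex.differentiableAt_Gamma _ fun k hk => ?_) (by fun_prop)
    have := congrArg Complex.re hk
    simp only [Complex.sub_re, Complex.neg_re, Complex.natCast_re] at this
    have := hs j
    have : (0 : ℝ) ≤ k := Nat.cast_nonneg k
    linarith
  · exact (Complex.differentiable_one_div_Gamma _).comp s (f := fun s => (κ : ℂ) - w * s)
      (by fun_prop)
  · exact (differentiableAt_id.const_cpow (Or.inl (by exact_mod_cast hz.ne')))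

theorem integral_mellinKernel_eq (hn : w < n) (hb : ∀ j, σ₁ < (b j).re) (hw : 0 ≤ w)
    (hz : 0 < z) (hσ : σ₀ ≤ σ₁) :
    ∫ y : ℝ, mellinKernel b κ w z (σ₀ + y * Complex.I) =
      ∫ y : ℝ, mellinKernel b κ w z (σ₁ + y * Complex.I) :=
  (stripBound_mellinKernel hb hw hz).integral_vertical_eq
    (by nlinarith [Real.pi_pos]) hσ fun _ _ h1 =>
      differentiableAt_mellinKernel hz fun j => h1.trans_lt (hb j)

theorem integrable_mellinKernel {σ : ℝ} (hn : w < n) (hb : ∀ j, σ < (b j).re) (hw : 0 ≤ w)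
    (hz : 0 < z) (N : ℕ) :
    Integrable fun y : ℝ => ‖mellinKernel b κ w z (σ + y * Complex.I)‖ * (1 + |y|) ^ N :=
  (stripBound_mellinKernel hb hw hz).integrable_vertical (by nlinarith [Real.pi_pos])
    (fun _ hs => differentiableAt_mellinKernel hz fun j => hs.trans_lt (hb j)) N

theorem continuous_mellinKernel {σ : ℝ} (hb : ∀ j, σ < (b j).re) (hz : 0 < z) :
    Continuous fun y : ℝ => mellinKernel b κ w z (σ + y * Complex.I) :=
  StripBound.continuous_vertical fun _ hs =>
    differentiableAt_mellinKernel hz fun j => hs.trans_lt (hb j)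

theorem powerDominated_mellinKernel {σ : ℝ} (hn : w < n) (hb : ∀ j, σ < (b j).re) (hw : 0 ≤ w)
    (hz : 0 < z) (c : ℂ) :
    PowerDominated volume (fun y : ℝ => c * mellinKernel b κ w z (σ + y * Complex.I))
      (fun y => σ + y * Complex.I) := by
  have hc := (continuous_mellinKernel (κ := κ) (w := w) hb hz).const_mul c
  refine ⟨hc.aestronglyMeasurable, by fun_prop, fun N t ht => ?_⟩
  refine ((integrable_mellinKernel (κ := κ) hn hb hw hz N).const_mul
    (‖c‖ * (1 + |σ|) ^ N * t ^ σ)).mono' ?_ (Eventually.of_forall fun y => ?_)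
  · have : Continuous fun y : ℝ => t ^ ((σ : ℂ) + y * Complex.I).re := by
      simpa using continuous_const
    exact ((hc.norm.mul (by fun_prop)).mul this).aestronglyMeasurable
  · have h1 : 1 + ‖(σ : ℂ) + y * Complex.I‖ ≤ (1 + |σ|) * (1 + |y|) := by
      have := norm_add_le (σ : ℂ) (y * Complex.I)
      rw [norm_mul, Complex.norm_I, Complex.norm_real, Complex.norm_real, Real.norm_eq_abs,
        Real.norm_eq_abs] at this
      nlinarith [mul_nonneg (abs_nonneg σ) (abs_nonneg y)]
    rw [Real.norm_of_nonneg (by positivity), norm_mul]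
    simp only [Complex.add_re, Complex.ofReal_re, Complex.re_ofReal_mul, Complex.I_re, mul_zero,
      add_zero]
    calc _ ≤ ‖c‖ * ‖mellinKernel b κ w z (σ + y * Complex.I)‖ * ((1 + |σ|) * (1 + |y|)) ^ N *
          t ^ σ := by gcongr
      _ = _ := by rw [mul_pow]; ring

end mellinKernel

end

/-! ### The Fox function solution. -/

section

variable {α : ℝ} {m : ℕ} {d A B C : ℝ}

theorem foxHIntegrand_eq_mellinKernel (b : Fin (m + 2) → ℂ) (w z : ℝ) (s : ℂ) :
    foxHIntegrand (m + 2) 0 ![1] ![w] b (fun _ => 1) z s = mellinKernel b 1 w z s := by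
  simp [foxHIntegrand, mellinKernel]

theorem foxHConverges_of_lt {b : Fin (m + 2) → ℂ} {w z γ : ℝ} (hw : 0 ≤ w) (hn : w < m + 2)
    (hb : ∀ j, γ < (b j).re) (hz : 0 < z) :
    FoxHConverges (m + 2) 0 ![1] ![w] b (fun _ => 1) γ z := by
  simp only [FoxHConverges, foxHIntegrand_eq_mellinKernel]
  have := integrable_mellinKernel (κ := 1) (n := m + 2) (by push_cast; exact hn) hb hw hz 0
  simp only [pow_zero, mul_one] at this
  exact (integrable_norm_iff (continuous_mellinKernel hb hz).aestronglyMeasurable).1 this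

/-- The recurrence behind the Fox solution. Replacing `s` by `s - 1` multiplies each `Γ(b_j - s)` by
`b_j - s`. The factors with `b_j = j/(α+m)` are exactly those that turn `1/Γ(1 - (α+m)s + m)` into
`1/Γ(1 - (α+m)s)`, so only the two indicial factors survive. -/
theorem mellinKernel_foxLower_sub_one (hw : 0 < α + m) {s₁ s₂ s : ℂ}
    (hs : ∀ j, s.re < (foxLower α m s₁ s₂ j).re) {z : ℝ} (hz : 0 < z) :
    mellinKernel (foxLower α m s₁ s₂) (1 - α) (α + m) z (s - 1) * (z * (α + m) ^ m : ℝ) =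
      (-s - s₁ / (α + m : ℝ)) * (-s - s₂ / (α + m : ℝ)) *
        mellinKernel (foxLower α m s₁ s₂) 1 (α + m) z s := by
  have hw' : ((α + m : ℝ) : ℂ) ≠ 0 := by exact_mod_cast hw.ne'
  have hzc : (z : ℂ) ≠ 0 := by exact_mod_cast hz.ne'
  have e1 : ∀ j, Complex.Gamma (foxLower α m s₁ s₂ j - (s - 1)) =
      (foxLower α m s₁ s₂ j - s) * Complex.Gamma (foxLower α m s₁ s₂ j - s) := fun j => by
    rw [← Complex.Gamma_add_one]
    · ring_nf
    · intro h
      have := congrArg Complex.re h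
      have := hs j
      simp only [Complex.sub_re, Complex.zero_re] at *
      linarith
  have e2 := inv_Gamma_eq_prod_mul m ((1 : ℝ) - (α + m : ℝ) * s)
  have e3 : ∏ i ∈ Finset.range m, (((1 : ℝ) : ℂ) - (α + m : ℝ) * s + i) =
      ((α + m : ℝ) : ℂ) ^ m * ∏ i : Fin m, (((((i : ℕ) + 1 : ℝ) / (α + m) : ℝ) : ℂ) - s) := by
    rw [Finset.prod_range]
    conv_rhs => rw [← Fintype.card_fin m, ← Finset.card_univ, ← Finset.prod_const,
      Finset.card_univ, Fintype.card_fin, ← Finset.prod_mul_distrib]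
    refine Finset.prod_congr rfl fun i _ => ?_
    rw [Complex.ofReal_div]
    field_simp
    push_cast
    ring
  have e4 : ∏ j, (foxLower α m s₁ s₂ j - s) = (-s - s₁ / (α + m : ℝ)) * (-s - s₂ / (α + m : ℝ)) *
      ∏ i : Fin m, (((((i : ℕ) + 1 : ℝ) / (α + m) : ℝ) : ℂ) - s) := by
    rw [Fin.prod_univ_succ, Fin.prod_univ_succ]
    simp only [foxLower, Matrix.cons_val_zero, Matrix.cons_val_succ]
    ring
  simp only [mellinKernel, e1, Finset.prod_mul_distrib]
  rw [e2, e3, e4, Complex.cpow_sub _ _ hzc, Complex.cpow_one,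
    show ((1 - α : ℝ) : ℂ) - (α + m : ℝ) * (s - 1) = (1 : ℝ) - (α + m : ℝ) * s + m by
      push_cast; ring, Complex.ofReal_mul, Complex.ofReal_pow]
  field_simp

theorem ofReal_rpow_cpow {x : ℝ} (hx : 0 < x) (q : ℝ) (s : ℂ) :
    ((x ^ q : ℝ) : ℂ) ^ s = (x : ℂ) ^ (q * s) := by
  have hxc : (x : ℂ) ≠ 0 := by exact_mod_cast hx.ne'
  have hxq : ((x ^ q : ℝ) : ℂ) ≠ 0 := by exact_mod_cast (Real.rpow_pos_of_pos hx q).ne'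
  rw [Complex.cpow_def_of_ne_zero hxq, Complex.cpow_def_of_ne_zero hxc,
    ← Complex.ofReal_log (Real.rpow_pos_of_pos hx q).le, ← Complex.ofReal_log hx.le,
    Real.log_rpow hx]
  push_cast
  ring_nf

theorem foxH_arg_pos (hw : 0 < α + m) (hA : 0 < A) (hd : d ≠ 2) {x t : ℝ} (hx : 0 < x)
    (ht : 0 < t) : 0 < x ^ (2 - d) / (A * (d - 2) ^ 2 * (α + m) ^ m * t ^ (α + m)) := by
  have : d - 2 ≠ 0 := sub_ne_zero.2 hd
  positivity

/-- The Mellin-Barnes solution on a line to the left of the imaginary axis. -/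
theorem isSolution_mellin (hα : 0 < α) (hα2 : α < 2) (hA : 0 < A) (hd : d ≠ 2) {a : ℝ} {r : ℂ}
    (hr : r ^ 2 = (((1 - B / A) ^ 2 - 4 * C / A : ℝ) : ℂ)) {s₁ s₂ : ℂ}
    (hs₁ : s₁ = sRoot α m d A B a r) (hs₂ : s₂ = sRoot α m d A B a (-r)) {γ : ℝ} (hγ : γ ≤ 0)
    (hb : ∀ j, γ < (foxLower α m s₁ s₂ j).re) (c : ℂ) {u : ℝ → ℝ → ℂ}
    (hu : ∀ x : ℝ, 0 < x → ∀ t : ℝ, 0 < t → u x t = c * ((x ^ a : ℝ) : ℂ) *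
      ∫ y : ℝ, mellinKernel (foxLower α m s₁ s₂) 1 (α + m)
        (x ^ (2 - d) / (A * (d - 2) ^ 2 * (α + m) ^ m * t ^ (α + m))) (γ + y * Complex.I)) :
    IsSolution α m d A B C u := by
  have hw : 0 < α + m := by positivity
  have hd' : d - 2 ≠ 0 := sub_ne_zero.2 hd
  have hn : α + m < (m + 2 : ℕ) := by push_cast; linarith
  set Z := (A * (d - 2) ^ 2 * (α + m) ^ m)⁻¹ with hZdef
  have hZ : 0 < Z := by positivity
  have hker : ∀ x : ℝ, 0 < x → ∀ t : ℝ, 0 < t → ∀ (κ : ℝ) (s : ℂ),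
      mellinKernel (foxLower α m s₁ s₂) κ (α + m) Z s *
        ((x : ℂ) ^ ((2 - d : ℝ) * s) * (t : ℂ) ^ ((-(α + m) : ℝ) * s)) =
      mellinKernel (foxLower α m s₁ s₂) κ (α + m)
        (x ^ (2 - d) / (A * (d - 2) ^ 2 * (α + m) ^ m * t ^ (α + m))) s := by
    intro x hx t ht κ s
    have e : x ^ (2 - d) / (A * (d - 2) ^ 2 * (α + m) ^ m * t ^ (α + m)) =
        Z * (x ^ (2 - d) * t ^ (-(α + m))) := by
      rw [hZdef, Real.rpow_neg ht.le]
      field_simp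
    rw [e, mellinKernel, mellinKernel, Complex.ofReal_mul Z,
      Complex.mul_cpow_ofReal_nonneg hZ.le (by positivity), Complex.ofReal_mul,
      Complex.mul_cpow_ofReal_nonneg (by positivity) (by positivity), ofReal_rpow_cpow hx,
      ofReal_rpow_cpow ht]
    ring
  have hdom := powerDominated_mellinKernel (κ := 1) hn hb hw.le hZ c
  refine isSolution_of_superposition (q₀ := a) (q₁ := 2 - d) (p₀ := 0) (p₁ := -(α + m)) hdom
    neg_one_lt_zero (fun y _ => ?_) (fun x hx t ht => ?_) fun x hx t ht => ?_
  -- With `γ ≤ 0` the powers of `t` have real part at least 0, so `ρ = 0` is admissible.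
  · have : 0 ≤ (α + m) * -γ := mul_nonneg hw.le (by linarith)
    simp
    linarith
  · have hxc : (x : ℂ) ≠ 0 := by exact_mod_cast hx.ne'
    rw [hu x hx t ht, ← integral_const_mul]
    refine integral_congr_ae (Eventually.of_forall fun y => ?_)
    simp only
    rw [← hker x hx t ht, Complex.cpow_add _ _ hxc, ← Complex.ofReal_cpow hx.le,
      Complex.ofReal_zero, zero_add]
    ring
  · have hxc : (x : ℂ) ≠ 0 := by exact_mod_cast hx.ne'
    have htc : (t : ℂ) ≠ 0 := by exact_mod_cast ht.ne'
    set z := x ^ (2 - d) / (A * (d - 2) ^ 2 * (α + m) ^ m * t ^ (α + m)) with hz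
    have hz0 : 0 < z := foxH_arg_pos hw hA hd hx ht
    have hshift := integral_mellinKernel_eq (κ := 1 - α) hn hb hw.le hz0
      (show γ - 1 ≤ γ by linarith)
    -- The fractional derivative only changes the upper parameter from `1` to `1 - α`.
    have hL : ∀ y : ℝ, c * mellinKernel (foxLower α m s₁ s₂) 1 (α + m) Z (γ + y * Complex.I) *
        (x : ℂ) ^ ((a : ℂ) + (2 - d : ℝ) * (γ + y * Complex.I)) *
        (Complex.Gamma ((0 : ℝ) + (-(α + m) : ℝ) * (γ + y * Complex.I) + 1) *
          (Complex.Gamma ((0 : ℝ) + (-(α + m) : ℝ) * (γ + y * Complex.I) + 1 - α))⁻¹) *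
        (t : ℂ) ^ (((0 : ℝ) : ℂ) + (-(α + m) : ℝ) * (γ + y * Complex.I) - α) =
        c * (x ^ a : ℝ) * (t ^ (-α) : ℝ) *
          mellinKernel (foxLower α m s₁ s₂) (1 - α) (α + m) z (γ + y * Complex.I) := by
      intro y
      rw [hz, ← hker x hx t ht]
      generalize hs : (γ : ℂ) + y * Complex.I = s
      have hΓ : Complex.Gamma ((1 : ℝ) - (α + m : ℝ) * s) ≠ 0 :=
        Complex.Gamma_ne_zero_of_re_pos (by
          have : 0 ≤ (α + m) * -γ := mul_nonneg hw.le (by linarith)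
          have h2 : ((1 : ℝ) - (α + m : ℝ) * s : ℂ).re = 1 - (α + m) * γ := by
            rw [← hs]
            simp
          rw [h2]
          linarith)
      rw [Complex.cpow_add _ _ hxc, ← Complex.ofReal_cpow hx.le, Complex.cpow_sub _ _ htc,
        ← Complex.ofReal_cpow ht.le, Real.rpow_neg ht.le, Complex.ofReal_zero, zero_add,
        show ((-(α + m) : ℝ) : ℂ) * s + 1 = (1 : ℝ) - (α + m : ℝ) * s by push_cast; ring,
        show (1 : ℝ) - (α + m : ℝ) * s - α = (1 - α : ℝ) - (α + m : ℝ) * s by push_cast; ring,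
        mellinKernel, mellinKernel, Complex.ofReal_inv (t ^ α), div_eq_mul_inv]
      generalize Complex.Gamma ((1 : ℝ) - (α + m : ℝ) * s) = g at *
      generalize (Complex.Gamma ((1 - α : ℝ) - (α + m : ℝ) * s))⁻¹ = g'
      generalize (Z : ℂ) ^ s = Zs
      field_simp
    -- By the recurrence the right side is the same kernel one unit to the left, so `hshift` equates
    -- the two integrals.
    have hR : ∀ y : ℝ, ((t ^ m * x ^ (d - 2) : ℝ) : ℂ) *
        (c * mellinKernel (foxLower α m s₁ s₂) 1 (α + m) Z (γ + y * Complex.I) *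
        (x : ℂ) ^ ((a : ℂ) + (2 - d : ℝ) * (γ + y * Complex.I)) *
        (t : ℂ) ^ (((0 : ℝ) : ℂ) + (-(α + m) : ℝ) * (γ + y * Complex.I)) *
        (A * (a + (2 - d : ℝ) * (γ + y * Complex.I)) *
          (a + (2 - d : ℝ) * (γ + y * Complex.I) - 1) +
          B * (a + (2 - d : ℝ) * (γ + y * Complex.I)) + C)) =
        c * (x ^ a : ℝ) * (t ^ (-α) : ℝ) *
          mellinKernel (foxLower α m s₁ s₂) (1 - α) (α + m) z ((γ - 1 : ℝ) + y * Complex.I) := by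
      intro y
      have hk := mellinKernel_foxLower_sub_one (s := (γ : ℂ) + y * Complex.I) hw
        (fun j => by simpa using hb j) hz0
      have hk2 := hker x hx t ht 1 ((γ : ℂ) + y * Complex.I)
      rw [show (((γ - 1 : ℝ) : ℂ) + y * Complex.I) = (γ : ℂ) + y * Complex.I - 1 by
        push_cast; ring]
      generalize (γ : ℂ) + y * Complex.I = s at *
      have hi := indicial_eq_mul (a := a) hw hA.ne' hd hr (-s)
      rw [show (a : ℂ) + (d - 2 : ℝ) * -s = a + (2 - d : ℝ) * s by push_cast; ring, ← hs₁, ← hs₂]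
        at hi
      rw [hi, Complex.cpow_add _ _ hxc, ← Complex.ofReal_cpow hx.le, Complex.ofReal_zero, zero_add]
      have hq : t ^ m * x ^ (d - 2) * (A * (d - 2) ^ 2) * (z * (α + m) ^ m) = t ^ (-α) := by
        rw [hz, Real.rpow_neg ht.le, Real.rpow_add ht, Real.rpow_natCast, Real.rpow_sub hx,
          Real.rpow_sub hx]
        field_simp
      rw [← hz] at hk2
      rw [← hk2] at hk
      rw [← hq]
      simp only [Complex.ofReal_mul] at hk ⊢
      linear_combination (-(c * (x ^ a : ℝ) * (t ^ m : ℝ) * (x ^ (d - 2) : ℝ) *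
        (A * ((d - 2) ^ 2 : ℝ)))) * hk
    simp only [hL]
    rw [← integral_const_mul]
    simp only [hR]
    rw [integral_const_mul, integral_const_mul, hshift]

theorem isSolution_foxH (hα : 0 < α) (hα2 : α < 2) (hA : 0 < A) (hd : d ≠ 2) {a : ℝ} {r : ℂ}
    (hr : r ^ 2 = (((1 - B / A) ^ 2 - 4 * C / A : ℝ) : ℂ)) {s₁ s₂ : ℂ}
    (hs₁ : s₁ = sRoot α m d A B a r) (hs₂ : s₂ = sRoot α m d A B a (-r)) {γ : ℝ}
    (hb : ∀ j, γ < (foxLower α m s₁ s₂ j).re) (c : ℂ) :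
    IsSolution α m d A B C (fun x t => c * ((x ^ a : ℝ) : ℂ) *
      foxH (m + 2) 0 ![1] ![α + m] (foxLower α m s₁ s₂) (fun _ => 1) γ
        ((x ^ (2 - d) / (A * (d - 2) ^ 2 * (α + m) ^ m * t ^ (α + m)) : ℝ) : ℂ)) := by
  have hw : 0 < α + m := by positivity
  -- All poles lie to the right of `γ`, so the line may be moved left to a nonpositive abscissa.
  refine isSolution_mellin (γ := min γ 0) hα hα2 hA hd hr hs₁ hs₂ (min_le_right _ _)
    (fun j => (min_le_left _ _).trans_lt (hb j)) (c * (2 * Real.pi : ℂ)⁻¹) fun x hx t ht => ?_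
  rw [integral_mellinKernel_eq (by push_cast; linarith) hb hw.le (foxH_arg_pos hw hA hd hx ht)
    (min_le_left γ 0)]
  simp only [foxH, foxHIntegrand_eq_mellinKernel]
  ring

end

end FracDiff

end

/-! ### The three cases of the theorem. -/

theorem theorem1 (α : ℝ) (hα : 0 < α) (m : ℕ) (d A B C : ℝ) (hA : 0 < A) (a : ℝ)
    (r : ℂ) (hr : r ^ 2 = (((1 - B / A) ^ 2 - 4 * C / A : ℝ) : ℂ))
    (s₁ s₂ : ℂ) (hs₁ : s₁ = FracDiff.sRoot α m d A B a r)
    (hs₂ : s₂ = FracDiff.sRoot α m d A B a (-r)) :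
    -- `0 < α < 2`, `d ≠ 2`
    (α < 2 → d ≠ 2 → ∀ γ : ℝ,
      FracDiff.IsSeparatingLine (m + 2) 0 ![1] ![α + m]
        (FracDiff.foxLower α m s₁ s₂) (fun _ => 1) γ →
      (∀ z : ℝ, 0 < z → FracDiff.FoxHConverges (m + 2) 0 ![1] ![α + m]
        (FracDiff.foxLower α m s₁ s₂) (fun _ => 1) γ z) ∧
      ∀ c₁ : ℂ, FracDiff.IsSolution α m d A B C (fun x t =>
        c₁ * ((x ^ a : ℝ) : ℂ) *
          FracDiff.foxH (m + 2) 0 ![1] ![α + m] (FracDiff.foxLower α m s₁ s₂) (fun _ => 1) γ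
            ((x ^ (2 - d) / (A * (d - 2) ^ 2 * (α + m) ^ m * t ^ (α + m)) : ℝ) : ℂ))) ∧
    -- `α > 2`, `d ≠ 2`
    (2 < α → d ≠ 2 → ∀ c : ℕ → ℂ,
      (∀ k ∈ Finset.Icc 1 (⌊α⌋₊ + 1), c k ≠ 0 →
        FracDiff.WrightDefined (FracDiff.wrightUpper₂ α m k s₁ s₂) (fun _ => 1)) →
      (∀ k ∈ Finset.Icc 1 (⌊α⌋₊ + 1), c k ≠ 0 → ∀ z : ℂ,
        Summable (FracDiff.wrightTerm (FracDiff.wrightUpper₂ α m k s₁ s₂) (fun _ => 1)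
          ![((1 + α - k : ℝ) : ℂ)] ![α + m] z)) ∧
      FracDiff.IsSolution α m d A B C (fun x t =>
        ((x ^ a : ℝ) : ℂ) * ∑ k ∈ Finset.Icc 1 (⌊α⌋₊ + 1),
          c k * ((x ^ ((d - 2) * (α - k) / (α + m)) : ℝ) : ℂ) * ((t ^ (α - k) : ℝ) : ℂ) *
            FracDiff.wright (FracDiff.wrightUpper₂ α m k s₁ s₂) (fun _ => 1)
              ![((1 + α - k : ℝ) : ℂ)] ![α + m]
              ((A * (d - 2) ^ 2 * (α + m) ^ m * x ^ (d - 2) * t ^ (α + m) : ℝ) : ℂ))) ∧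
    -- `d = 2`
    (d = 2 → ∀ c : ℕ → ℂ,
      (∀ k ∈ Finset.Icc 1 (⌊α⌋₊ + 1), c k ≠ 0 →
        FracDiff.WrightDefined (FracDiff.wrightUpper α m k) (fun _ => 1)) →
      (∀ k ∈ Finset.Icc 1 (⌊α⌋₊ + 1), c k ≠ 0 → ∀ z : ℂ,
        Summable (FracDiff.wrightTerm (FracDiff.wrightUpper α m k) (fun _ => 1)
          ![((1 + α - k : ℝ) : ℂ)] ![α + m] z)) ∧
      FracDiff.IsSolution α m d A B C (fun x t =>
        ((x ^ a : ℝ) : ℂ) * ∑ k ∈ Finset.Icc 1 (⌊α⌋₊ + 1),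
          c k * ((t ^ (α - k) : ℝ) : ℂ) *
            FracDiff.wright (FracDiff.wrightUpper α m k) (fun _ => 1)
              ![((1 + α - k : ℝ) : ℂ)] ![α + m]
              (((A * a ^ 2 - A * a + B * a + C) * (α + m) ^ m * t ^ (α + m) : ℝ) : ℂ))) := by
  have hm : (0 : ℝ) ≤ m := Nat.cast_nonneg m
  refine ⟨fun hα2 hd γ hγ => ?_, fun hα2 hd c hc => ⟨fun k hk hck z => ?_, ?_⟩, ?_⟩
  · have hb : ∀ j, γ < (FracDiff.foxLower α m s₁ s₂ j).re := fun j => by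
      simpa using hγ.1 j j.isLt
    exact ⟨fun z hz => FracDiff.foxHConverges_of_lt (by linarith) (by linarith) hb hz,
      fun c₁ => FracDiff.isSolution_foxH hα hα2 hA hd hr hs₁ hs₂ hb c₁⟩
  · exact FracDiff.summable_wrightTerm_wrightUpper₂ hα2 (hc k hk hck) _ z
  · simp only [Finset.mul_sum]
    refine FracDiff.isSolution_sum _ fun k hk => ?_
    -- For `c k = 0` the Wright series may be undefined, but the summand is the zero solution.
    by_cases hck : c k = 0
    · simpa [hck] using FracDiff.isSolution_zero
    · convert FracDiff.isSolution_wrightUpper₂ hα2 hk hA.ne' hd hr hs₁ hs₂ (hc k hk hck) (c k)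
        using 3
      ring
  · rintro rfl c hc
    refine ⟨fun k hk hck z => FracDiff.summable_wrightTerm_wrightUpper hα (hc k hk hck) _ z, ?_⟩
    simp only [Finset.mul_sum]
    refine FracDiff.isSolution_sum _ fun k hk => ?_
    by_cases hck : c k = 0
    · simpa [hck] using FracDiff.isSolution_zero
    · convert FracDiff.isSolution_wrightUpper hα hk (hc k hk hck) a (c k) using 3
      ring
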